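/- Let $\sigma\ge 0$, let $G\in\mathbf R^{K\times d}$, let $\Gamma\in\mathbf R^{K\times K}$ and $\Gamma_0\in\mathbf R^{d\times d}$ be symmetric positive definite, let $y\in\mathbf R^K$, and put $B^{-1}=\Gamma_0^{-1}+G^{T}\Gamma^{-1}G$ and $u_0=BG^{T}\Gamma^{-1}y$. Let $C:[0,\infty)\to\mathbf R^{d\times d}$ be a solution of $$\dot C(t)=-2\,C(t)B^{-1}C(t)+2\sigma C(t),\qquad t\ge 0,$$ with $C(0)$ symmetric positive semidefinite, and for $0\le s\le t$ let $U(s,t)$ be the fundamental matrix of $\dot\delta=-C(t)B^{-1}\delta$, i.e. $\partial_tU(s,t)=-C(t)B^{-1}U(s,t)$, $U(s,s)=I$. Let $f^1$ and $f^2$ be two solutions on $[0,\infty)$ of the linear Fokker–Planck equation $$\partial_t f=\nabla\cdot\big(C(t)B^{-1}(u-u_0)\,f\big)+\sigma\,\nabla\cdot\big(C(t)\nabla f\big),$$ in the weak sense: $t\mapsto f_t$ is a narrowly continuous curve of probability measures on $\mathbf R^d$ and, for all $\varphi\in C_c^\infty(\mathbf R^d)$ and $t\ge 0$, $$\int\varphi\,df_t=\int\varphi\,df_0+\int_0^t\!\int\Big(\sigma\sum_{i,j}C_{ij}(s)\,\partial_i\partial_j\varphi(u)-\nabla\varphi(u)\cdot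 C(s)B^{-1}(u-u_0)\Big)df_s(u)\,ds.$$ Let $W_2(\mu,\nu)=\big(\inf_\gamma\int|x-y|^2\,d\gamma(x,y)\big)^{1/2}\in[0,\infty]$, the infimum being over all couplings $\gamma$ of $\mu$ and $\nu$, and let $\|\cdot\|_2$ be the operator norm of matrices induced by the Euclidean norm. Then, for all $t\ge0$, $$W_2(f^1_t,f^2_t)\le\sqrt{\|U(0,t)^{T}U(0,t)\|_2}\;W_2(f^1_0,f^2_0).$$ If moreover $C(0)$ is positive definite and $\max(\|C(0)\|_2,\|B\|_2)\le M$, $\max(\|C(0)^{-1}\|_2,\|B^{-1}\|_2)\le m$, then, for all $t\ge 0$, $$W_2(f^1_t,f^2_t)\le\sqrt{mM}\;\frac{e^{-\sigma t}}{\sqrt{\alpha(t)}}\;W_2(f^1_0,f^2_0),\qquad \alpha(t)=\begin{cases}2t+1&\text{if }\sigma=0,\\ \frac1\sigma(1-e^{-2\sigma t})+e^{-2\sigma t}&\text{if }\sigma>0.\end{cases}$$ -/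

import Mathlib

open MeasureTheory Set Matrix
open scoped ENNReal ContDiff Matrix.Norms.L2Operator

namespace EnsembleKalman

/-- The matrix `B`, with inverse `B⁻¹ = Γ₀⁻¹ + Gᵀ Γ⁻¹ G`. -/
noncomputable def matB {d K : ℕ} (G : Matrix (Fin K) (Fin d) ℝ)
    (Γ : Matrix (Fin K) (Fin K) ℝ) (Γ₀ : Matrix (Fin d) (Fin d) ℝ) :
    Matrix (Fin d) (Fin d) ℝ :=
  (Γ₀⁻¹ + Gᵀ * Γ⁻¹ * G)⁻¹

/-- The minimizer `u₀ = B Gᵀ Γ⁻¹ y` of the regularized least squares functional. -/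
noncomputable def minimizer {d K : ℕ} (G : Matrix (Fin K) (Fin d) ℝ)
    (Γ : Matrix (Fin K) (Fin K) ℝ) (Γ₀ : Matrix (Fin d) (Fin d) ℝ)
    (y : EuclideanSpace ℝ (Fin K)) : EuclideanSpace ℝ (Fin d) :=
  toEuclideanLin (matB G Γ Γ₀ * Gᵀ * Γ⁻¹) y

/-- `C` solves `C' = -2 C B⁻¹ C + 2 σ C` on `[0, ∞)` (one-sided derivative at `0`). -/
def IsRiccatiSolution {d : ℕ} (σ : ℝ) (B : Matrix (Fin d) (Fin d) ℝ)
    (C : ℝ → Matrix (Fin d) (Fin d) ℝ) : Prop :=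
  ∀ t : ℝ, 0 ≤ t →
    HasDerivWithinAt C (-(2 : ℝ) • (C t * B⁻¹ * C t) + (2 * σ) • C t) (Ici 0) t

/-- `U s t`, `0 ≤ s ≤ t`, is the fundamental matrix of `δ' = -C(t) B⁻¹ δ`:
`∂ₜ U(s, t) = -C(t) B⁻¹ U(s, t)` and `U(s, s) = I`. -/
def IsFundamentalMatrix {d : ℕ} (B : Matrix (Fin d) (Fin d) ℝ)
    (C : ℝ → Matrix (Fin d) (Fin d) ℝ) (U : ℝ → ℝ → Matrix (Fin d) (Fin d) ℝ) : Prop :=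
  ∀ s : ℝ, 0 ≤ s → U s s = 1 ∧
    ∀ t : ℝ, s ≤ t → HasDerivWithinAt (U s) (-(C t * B⁻¹ * U s t)) (Ici s) t

/-- The formal adjoint, applied to `φ`, of the operator
`f ↦ ∇ · (A B⁻¹ (u - u₀) f) + σ ∇ · (A ∇ f)` for a symmetric matrix `A`, that is
`σ ∑ᵢⱼ Aᵢⱼ ∂ᵢ∂ⱼ φ(u) - ∇φ(u) · A B⁻¹ (u - u₀)`. -/
noncomputable def adjointOperator {d : ℕ} (σ : ℝ) (B : Matrix (Fin d) (Fin d) ℝ)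
    (u₀ : EuclideanSpace ℝ (Fin d)) (A : Matrix (Fin d) (Fin d) ℝ)
    (φ : EuclideanSpace ℝ (Fin d) → ℝ) (u : EuclideanSpace ℝ (Fin d)) : ℝ :=
  σ * (∑ i, ∑ j, A i j *
      fderiv ℝ (fderiv ℝ φ) u (EuclideanSpace.single i 1) (EuclideanSpace.single j 1))
    - fderiv ℝ φ u (toEuclideanLin (A * B⁻¹) (u - u₀))

/-- Weak solutions on `[0, ∞)`, as narrowly continuous curves of probability measures, of
`∂ₜ f = ∇ · (C(t) B⁻¹ (u - u₀) f) + σ ∇ · (C(t) ∇ f)`. -/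
structure IsFokkerPlanckSolution {d : ℕ} (σ : ℝ) (B : Matrix (Fin d) (Fin d) ℝ)
    (u₀ : EuclideanSpace ℝ (Fin d)) (C : ℝ → Matrix (Fin d) (Fin d) ℝ)
    (f : ℝ → ProbabilityMeasure (EuclideanSpace ℝ (Fin d))) : Prop where
  continuousOn : ContinuousOn f (Ici 0)
  weak_equation : ∀ φ : EuclideanSpace ℝ (Fin d) → ℝ, ContDiff ℝ ∞ φ → HasCompactSupport φ →
    ∀ t : ℝ, 0 ≤ t →
      ∫ u, φ u ∂(f t : Measure (EuclideanSpace ℝ (Fin d))) =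
        ∫ u, φ u ∂(f 0 : Measure (EuclideanSpace ℝ (Fin d))) +
          ∫ s in (0 : ℝ)..t,
            (∫ u, adjointOperator σ B u₀ (C s) φ u ∂(f s : Measure (EuclideanSpace ℝ (Fin d))))

/-- The transference plans between `μ` and `ν`. -/
def couplings {d : ℕ} (μ ν : Measure (EuclideanSpace ℝ (Fin d))) :
    Set (Measure (EuclideanSpace ℝ (Fin d) × EuclideanSpace ℝ (Fin d))) :=
  {γ | γ.map Prod.fst = μ ∧ γ.map Prod.snd = ν}

/-- The Wasserstein distance `W₂` for the Euclidean norm (possibly `∞` if the second moments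
are infinite). -/
noncomputable def wasserstein2 {d : ℕ}
    (μ ν : ProbabilityMeasure (EuclideanSpace ℝ (Fin d))) : ℝ≥0∞ :=
  (⨅ γ ∈ couplings (μ : Measure (EuclideanSpace ℝ (Fin d))) ν,
    ∫⁻ p, edist p.1 p.2 ^ 2 ∂γ) ^ (1 / 2 : ℝ)

/-- `α(t) = 2t + 1` if `σ = 0`, and `(1 - exp(-2σt))/σ + exp(-2σt)` otherwise. -/
noncomputable def alpha (σ t : ℝ) : ℝ :=
  if σ = 0 then 2 * t + 1
  else 1 / σ * (1 - Real.exp (-2 * σ * t)) + Real.exp (-2 * σ * t)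

end EnsembleKalman

/-! The drift is affine with fixed point `u₀` and the diffusion matrix does not depend on `u`, so
the equation is of Ornstein–Uhlenbeck type. With `V t = U 0 t`, the law `f t` is that of `u₀ + V t
(X - u₀) + Z`, where `X` has law `f 0` and `Z` is an independent centred Gaussian whose covariance
depends only on `t`, `σ` and `C` (`IsFokkerPlanckSolution.eq_conv`). Driving both solutions by the
same `Z` turns a coupling of the initial laws into one of the laws at time `t`. The difference of
the two points is multiplied by `V t`, so `W₂` grows by at most `‖V t‖`, which is the first
estimate.

The representation follows from characteristic functions. A plane wave whose frequency solves the
adjoint linear equation and whose amplitude compensates the diffusion solves the backward equation,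
so its integral is conserved (`IsFokkerPlanckSolution.integral_wave`). Plane waves are not compactly
supported and no moments are assumed. They are cut off by `χ (ρ • (u - u₀))`: the error is bounded
uniformly in `ρ` and `u` and vanishes pointwise as `ρ → 0`, so dominated convergence removes it.

For the second estimate, `B⁻¹` and `C 0` are diagonalized simultaneously, which reduces the Riccati
equation to scalar Bernoulli equations and makes `V` explicit (`exists_riccati_flow`). A scalar
inequality bounds `V (C 0) Vᵀ` by `M / (1 + 2 ∫₀ᵗ exp (2σs) ds)`, and `C 0 ≥ m⁻¹` converts this into
a bound on `V Vᵀ`. -/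

namespace EnsembleKalman

/-! ### Explicit solution of the matrix Riccati equation. -/

/-- Simultaneous diagonalization by congruence of a positive definite and a positive semidefinite
matrix. -/
theorem exists_simultaneous_diagonalization {d : ℕ} {P A : Matrix (Fin d) (Fin d) ℝ}
    (hP : P.PosDef) (hA : A.PosSemidef) :
    ∃ (S S' : Matrix (Fin d) (Fin d) ℝ) (l : Fin d → ℝ), S * S' = 1 ∧ S' * S = 1 ∧
      P = Sᵀ * S ∧ A = S' * diagonal l * S'ᵀ ∧ ∀ i, 0 ≤ l i := by
  obtain ⟨R, hR⟩ : ∃ R : Matrix (Fin d) (Fin d) ℝ, P = Rᵀ * R := by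
    open scoped MatrixOrder in
    obtain ⟨R, hR⟩ := CStarAlgebra.nonneg_iff_eq_star_mul_self.1
      (Matrix.nonneg_iff_posSemidef.2 hP.posSemidef)
    exact ⟨R, by rw [hR, star_eq_conjTranspose, conjTranspose_eq_transpose_of_trivial]⟩
  have hRu : IsUnit R.det := by
    have h1 : IsUnit (P.det) := (Matrix.isUnit_iff_isUnit_det _).1 hP.isUnit
    rw [hR, det_mul] at h1
    exact isUnit_of_mul_isUnit_right h1
  have h1 : R * R⁻¹ = 1 := Matrix.mul_nonsing_inv _ hRu
  have h2 : R⁻¹ * R = 1 := Matrix.nonsing_inv_mul _ hRu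
  -- The change of basis `R` reduces the form `P` to the identity, which a further orthogonal change
  -- `Q` preserves. `A` transforms like `P⁻¹`, as a covariance does, so it is `R * A * Rᵀ` that `Q`
  -- has to diagonalize.
  have hH : (R * A * Rᵀ).PosSemidef := by
    simpa [conjTranspose_eq_transpose_of_trivial] using hA.mul_mul_conjTranspose_same R
  obtain ⟨Q, l, hQ1, hQ2, hl, hQ⟩ : ∃ (Q : Matrix (Fin d) (Fin d) ℝ) (l : Fin d → ℝ),
      Q * Qᵀ = 1 ∧ Qᵀ * Q = 1 ∧ (∀ i, 0 ≤ l i) ∧ R * A * Rᵀ = Q * diagonal l * Qᵀ := by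
    refine ⟨hH.isHermitian.eigenvectorUnitary, hH.isHermitian.eigenvalues, ?_, ?_,
      hH.eigenvalues_nonneg, ?_⟩
    · have := Unitary.coe_mul_star_self hH.isHermitian.eigenvectorUnitary
      rwa [Unitary.coe_star, star_eq_conjTranspose, conjTranspose_eq_transpose_of_trivial] at this
    · have := Unitary.coe_star_mul_self hH.isHermitian.eigenvectorUnitary
      rwa [star_eq_conjTranspose, conjTranspose_eq_transpose_of_trivial] at this
    · have := hH.isHermitian.spectral_theorem
      rw [Unitary.conjStarAlgAut_apply, star_eq_conjTranspose,
        conjTranspose_eq_transpose_of_trivial] at this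
      exact this
  refine ⟨Qᵀ * R, R⁻¹ * Q, l, ?_, ?_, ?_, ?_, hl⟩
  · rw [Matrix.mul_assoc, ← Matrix.mul_assoc R, h1, Matrix.one_mul, hQ2]
  · rw [Matrix.mul_assoc, ← Matrix.mul_assoc Q, hQ1, Matrix.one_mul, h2]
  · rw [transpose_mul, transpose_transpose, Matrix.mul_assoc, ← Matrix.mul_assoc Q, hQ1,
      Matrix.one_mul, hR]
  · have h3 : Rᵀ * R⁻¹ᵀ = 1 := by rw [← transpose_mul, h2, transpose_one]
    have : A = R⁻¹ * (R * A * Rᵀ) * R⁻¹ᵀ := by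
      calc A = (R⁻¹ * R) * A * (Rᵀ * R⁻¹ᵀ) := by rw [h2, h3, Matrix.one_mul, Matrix.mul_one]
        _ = _ := by simp only [Matrix.mul_assoc]
    rw [this, hQ, transpose_mul]
    simp only [Matrix.mul_assoc]

theorem hasDerivAt_diagonal {n : ℕ} {g : ℝ → Fin n → ℝ} {g' : Fin n → ℝ} {t : ℝ}
    (hg : ∀ i, HasDerivAt (fun s => g s i) (g' i) t) :
    HasDerivAt (fun s => diagonal (g s)) (diagonal g') t :=
  ((Matrix.diagonalLinearMap (Fin n) ℝ ℝ).toContinuousLinearMap.hasFDerivAt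
    (x := g t)).comp_hasDerivAt t (hasDerivAt_pi.2 hg)

/-- The primitive `∫₀ᵗ exp(2σs) ds`. -/
noncomputable def expPrimitive (σ t : ℝ) : ℝ := ∫ s in (0 : ℝ)..t, Real.exp (2 * σ * s)

theorem hasDerivAt_expPrimitive (σ t : ℝ) :
    HasDerivAt (expPrimitive σ) (Real.exp (2 * σ * t)) t := by
  have h : Continuous fun s : ℝ => Real.exp (2 * σ * s) := by fun_prop
  exact (h.integral_hasStrictDerivAt 0 t).hasDerivAt

theorem expPrimitive_zero (σ : ℝ) : expPrimitive σ 0 = 0 := by simp [expPrimitive]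

theorem expPrimitive_nonneg (σ : ℝ) {t : ℝ} (ht : 0 ≤ t) : 0 ≤ expPrimitive σ t :=
  intervalIntegral.integral_nonneg ht fun _ _ => (Real.exp_pos _).le

/-- The integral equals `t` or `(exp (2σt) - 1) / (2σ)`. Writing both as one primitive merges the
two cases of the rate, which are not separated again. -/
theorem alpha_eq (σ t : ℝ) :
    alpha σ t = Real.exp (-2 * σ * t) * (1 + 2 * expPrimitive σ t) := by
  unfold alpha expPrimitive
  split_ifs with h
  · simp [h]; ring
  · rw [intervalIntegral.integral_comp_mul_left (fun x => Real.exp x) (by simpa using h),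
      integral_exp]
    have h1 : Real.exp (-2 * σ * t) = (Real.exp (2 * σ * t))⁻¹ := by
      rw [← Real.exp_neg]; ring_nf
    have h2 := Real.exp_pos (2 * σ * t)
    simp only [mul_zero, Real.exp_zero, smul_eq_mul, h1]
    field_simp
    ring

/-- The explicit solution of the Riccati equation `C' = -2 C P C + 2 σ C`, together with the
fundamental matrix `V` of `δ' = -C P δ` and its inverse `W`. -/
theorem exists_riccati_flow {d : ℕ} (σ : ℝ) {P A : Matrix (Fin d) (Fin d) ℝ}
    (hP : P.PosDef) (hA : A.PosSemidef) :
    ∃ V W C : ℝ → Matrix (Fin d) (Fin d) ℝ, V 0 = 1 ∧ C 0 = A ∧ ∀ t : ℝ, 0 ≤ t →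
      W t * V t = 1 ∧ V t * W t = 1 ∧
      HasDerivAt V (-(C t * P * V t)) t ∧
      HasDerivAt W (W t * C t * P) t ∧
      HasDerivAt C (-(2 : ℝ) • (C t * P * C t) + (2 * σ) • C t) t ∧
      C t = Real.exp (2 * σ * t) • (V t * A * (V t)ᵀ) ∧
      ∀ (M : ℝ) (x : Fin d → ℝ), x ⬝ᵥ A *ᵥ x ≤ M * (x ⬝ᵥ x) → x ⬝ᵥ P⁻¹ *ᵥ x ≤ M * (x ⬝ᵥ x) →
        x ⬝ᵥ (V t * A * (V t)ᵀ) *ᵥ x ≤ M / (1 + 2 * expPrimitive σ t) * (x ⬝ᵥ x) := by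
  obtain ⟨S, S', l, hS, hS', rfl, rfl, hl⟩ := exists_simultaneous_diagonalization hP hA
  have hST : S'ᵀ * Sᵀ = 1 := by rw [← transpose_mul, hS, transpose_one]
  -- In the diagonalizing coordinates the equations are `h' = -2 h² + 2 σ h` with `h 0 = l`, and `v'
  -- = -h v` with `v 0 = 1`. The Bernoulli substitution gives `h = exp (2σt) l / g`. Since `g' = 2 h
  -- g`, it also gives `v = g ^ (-1/2)`.
  set g : ℝ → Fin d → ℝ := fun t i => 1 + 2 * expPrimitive σ t * l i with hg
  set h : ℝ → Fin d → ℝ := fun t i => Real.exp (2 * σ * t) * l i / g t i with hh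
  have hgpos : ∀ t, 0 ≤ t → ∀ i, 0 < g t i := fun t ht i => by
    have := mul_nonneg (expPrimitive_nonneg σ ht) (hl i)
    simp only [hg]; nlinarith
  have hg' : ∀ t i, HasDerivAt (fun s => g s i) (2 * Real.exp (2 * σ * t) * l i) t := fun t i =>
    (((hasDerivAt_expPrimitive σ t).const_mul 2).mul_const (l i)).const_add 1
  have he' : ∀ t, HasDerivAt (fun s => Real.exp (2 * σ * s))
      (Real.exp (2 * σ * t) * (2 * σ)) t := fun t => by
    simpa using ((hasDerivAt_id t).const_mul (2 * σ)).exp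
  have key : ∀ (a b : Fin d → ℝ) (Z : Matrix (Fin d) (Fin d) ℝ),
      (S' * diagonal a * S) * (S' * diagonal b * Z) =
        S' * diagonal (fun i => a i * b i) * Z := fun a b Z => by
    rw [← diagonal_mul_diagonal]
    calc _ = S' * diagonal a * (S * S') * diagonal b * Z := by simp only [Matrix.mul_assoc]
      _ = _ := by rw [hS, Matrix.mul_one]; simp only [Matrix.mul_assoc]
  have keyP : ∀ a : Fin d → ℝ, (S' * diagonal a * S'ᵀ) * (Sᵀ * S) = S' * diagonal a * S :=
    fun a => by
    calc _ = S' * diagonal a * (S'ᵀ * Sᵀ) * S := by simp only [Matrix.mul_assoc]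
      _ = _ := by rw [hST, Matrix.mul_one]
  have hconj : ∀ (f : ℝ → Fin d → ℝ) (f' : Fin d → ℝ) (t : ℝ) (X Y : Matrix (Fin d) (Fin d) ℝ),
      (∀ i, HasDerivAt (fun s => f s i) (f' i) t) →
      HasDerivAt (fun s => X * diagonal (f s) * Y) (X * diagonal f' * Y) t :=
    fun f f' t X Y hf => ((hasDerivAt_diagonal hf).const_mul X).mul_const Y
  have hone : ∀ a : Fin d → ℝ, (∀ i, a i = 1) → S' * diagonal a * S = 1 := fun a ha => by
    rw [show a = fun _ => 1 from funext ha, diagonal_one, Matrix.mul_one, hS']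
  have hV : ∀ t, 0 ≤ t → S' * diagonal (fun i => (Real.sqrt (g t i))⁻¹) * S *
      (S' * diagonal l * S'ᵀ) * (S' * diagonal (fun i => (Real.sqrt (g t i))⁻¹) * S)ᵀ =
      S' * diagonal (fun i => l i / g t i) * S'ᵀ := fun t ht => by
    rw [transpose_mul, transpose_mul, diagonal_transpose, key, Matrix.mul_assoc (S' * _)]
    calc _ = S' * diagonal (fun i => (Real.sqrt (g t i))⁻¹ * l i) * (S'ᵀ * Sᵀ) *
          diagonal (fun i => (Real.sqrt (g t i))⁻¹) * S'ᵀ := by simp only [Matrix.mul_assoc]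
      _ = _ := by
        rw [hST, Matrix.mul_one, Matrix.mul_assoc S', diagonal_mul_diagonal]
        congr 3
        funext i
        have hs := Real.sqrt_pos.2 (hgpos t ht i)
        conv_rhs => rw [← Real.sq_sqrt (hgpos t ht i).le]
        field_simp
  refine ⟨fun t => S' * diagonal (fun i => (Real.sqrt (g t i))⁻¹) * S,
    fun t => S' * diagonal (fun i => Real.sqrt (g t i)) * S,
    fun t => S' * diagonal (h t) * S'ᵀ, ?_, ?_, fun t ht => ⟨?_, ?_, ?_, ?_, ?_, ?_, ?_⟩⟩
  · exact hone _ fun i => by simp [hg, expPrimitive_zero]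
  · simp [hh, hg, expPrimitive_zero]
  · rw [key]
    exact hone _ fun i => mul_inv_cancel₀ (Real.sqrt_pos.2 (hgpos t ht i)).ne'
  · rw [key]
    exact hone _ fun i => inv_mul_cancel₀ (Real.sqrt_pos.2 (hgpos t ht i)).ne'
  · have : HasDerivAt (fun t => S' * diagonal (fun i => (Real.sqrt (g t i))⁻¹) * S)
        (S' * diagonal (fun i => -(h t i * (Real.sqrt (g t i))⁻¹)) * S) t := by
      refine hconj (fun t i => (Real.sqrt (g t i))⁻¹) _ t S' S fun i => ?_
      have hp := hgpos t ht i
      have hs := Real.sqrt_pos.2 hp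
      refine ((hg' t i).sqrt hp.ne').fun_inv hs.ne' |>.congr_deriv ?_
      have hsq : h t i = Real.exp (2 * σ * t) * l i / Real.sqrt (g t i) ^ 2 := by
        rw [Real.sq_sqrt hp.le]
      rw [hsq]
      field_simp
    convert this using 1
    simp only [keyP, key]
    rw [← Matrix.neg_mul, ← Matrix.mul_neg, diagonal_neg]
  · have : HasDerivAt (fun t => S' * diagonal (fun i => Real.sqrt (g t i)) * S)
        (S' * diagonal (fun i => Real.sqrt (g t i) * h t i) * S) t := by
      refine hconj (fun t i => Real.sqrt (g t i)) _ t S' S fun i => ?_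
      have hp := hgpos t ht i
      have hs := Real.sqrt_pos.2 hp
      refine ((hg' t i).sqrt hp.ne').congr_deriv ?_
      have hsq : h t i = Real.exp (2 * σ * t) * l i / Real.sqrt (g t i) ^ 2 := by
        rw [Real.sq_sqrt hp.le]
      rw [hsq]
      field_simp
    convert this using 1
    rw [Matrix.mul_assoc _ _ (Sᵀ * S), keyP, key]
  · have : HasDerivAt (fun t => S' * diagonal (h t) * S'ᵀ)
        (S' * diagonal (fun i => -2 * (h t i * h t i) + 2 * σ * h t i) * S'ᵀ) t := by
      refine hconj h _ t S' S'ᵀ fun i => ?_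
      have hp := hgpos t ht i
      refine (((he' t).mul_const (l i)).fun_div (hg' t i) hp.ne').congr_deriv ?_
      simp only [hh]
      field_simp
      ring
    convert this using 1
    simp only [keyP, key]
    rw [← diagonal_add, Matrix.mul_add, Matrix.add_mul]
    congr 1
    · rw [← Matrix.smul_mul, ← Matrix.mul_smul, ← diagonal_smul]; rfl
    · rw [← Matrix.smul_mul, ← Matrix.mul_smul, ← diagonal_smul]; rfl
  · beta_reduce
    rw [hV t ht, ← Matrix.smul_mul, ← Matrix.mul_smul, ← diagonal_smul]
    congr 3
    funext i
    simp only [hh, Pi.smul_apply, smul_eq_mul]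
    ring
  · intro M x hM hM'
    have hquad : ∀ a : Fin d → ℝ,
        x ⬝ᵥ (S' * diagonal a * S'ᵀ) *ᵥ x = ∑ i, a i * (S'ᵀ *ᵥ x) i ^ 2 := fun a => by
      rw [← mulVec_mulVec, ← mulVec_mulVec, dotProduct_mulVec, ← mulVec_transpose, dotProduct]
      exact Finset.sum_congr rfl fun i _ => by rw [mulVec_diagonal]; ring
    have hPinv : (Sᵀ * S)⁻¹ = S' * Matrix.diagonal (fun _ => (1 : ℝ)) * S'ᵀ := by
      refine Matrix.inv_eq_left_inv ?_
      rw [keyP, diagonal_one, Matrix.mul_one, hS']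
    rw [hPinv, hquad] at hM'
    rw [hquad] at hM
    beta_reduce
    rw [hV t ht, hquad]
    have hb := expPrimitive_nonneg σ ht
    set b := expPrimitive σ t
    have hstep : ∀ i, l i / g t i * (S'ᵀ *ᵥ x) i ^ 2 ≤
        1 / (1 + 2 * b) ^ 2 * (l i * (S'ᵀ *ᵥ x) i ^ 2 + 2 * b * (1 * (S'ᵀ *ᵥ x) i ^ 2)) := by
      intro i
      -- After clearing denominators the difference of the two sides is `2 b (l - 1)² ≥ 0`; this is
      -- the harmonic–arithmetic mean inequality for `l` and `1` with weights `1` and `2 b`. In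
      -- matrix form, `V A Vᵀ ≤ (A + 2 b P⁻¹) / (1 + 2 b)²`.
      have h1 : l i / g t i ≤ 1 / (1 + 2 * b) ^ 2 * (l i + 2 * b) := by
        rw [div_le_iff₀ (hgpos t ht i), mul_assoc, one_div, ← div_eq_inv_mul,
          le_div_iff₀ (by positivity)]
        simp only [hg]
        nlinarith [mul_nonneg hb (sq_nonneg (l i - 1))]
      nlinarith [mul_le_mul_of_nonneg_right h1 (sq_nonneg ((S'ᵀ *ᵥ x) i))]
    calc _ ≤ ∑ i, 1 / (1 + 2 * b) ^ 2 *
          (l i * (S'ᵀ *ᵥ x) i ^ 2 + 2 * b * (1 * (S'ᵀ *ᵥ x) i ^ 2)) :=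
          Finset.sum_le_sum fun i _ => hstep i
      _ ≤ 1 / (1 + 2 * b) ^ 2 * (M * (x ⬝ᵥ x) + 2 * b * (M * (x ⬝ᵥ x))) := by
          rw [← Finset.mul_sum, Finset.sum_add_distrib, ← Finset.mul_sum]
          gcongr
      _ = _ := by field_simp

/-! ### Uniqueness for the Riccati equation and for the fundamental matrix. -/

/-- The right-hand side is quadratic, hence Lipschitz on the bounded set swept out by two solutions
on `[0, t]`, and Grönwall applies. This identifies the given `C` with the explicit solution. -/
theorem IsRiccatiSolution.eqOn {d : ℕ} {σ : ℝ} {B : Matrix (Fin d) (Fin d) ℝ}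
    {C C' : ℝ → Matrix (Fin d) (Fin d) ℝ} (hC : IsRiccatiSolution σ B C)
    (hC' : IsRiccatiSolution σ B C') (h0 : C 0 = C' 0) {t : ℝ} (ht : 0 ≤ t) : C t = C' t := by
  have hcont : ∀ D : ℝ → Matrix (Fin d) (Fin d) ℝ, IsRiccatiSolution σ B D →
      ContinuousOn D (Icc 0 t) := fun D hD s hs =>
    (hD s hs.1).continuousWithinAt.mono Icc_subset_Ici_self
  obtain ⟨K, hK⟩ := isCompact_Icc.exists_bound_of_continuousOn (hcont C hC)
  obtain ⟨K', hK'⟩ := isCompact_Icc.exists_bound_of_continuousOn (hcont C' hC')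
  have := eq_zero_of_abs_deriv_le_mul_abs_self_of_eq_zero_right
    (f := fun s => C s - C' s) (a := 0) (b := t)
    (f' := fun s => (-(2 : ℝ) • (C s * B⁻¹ * C s) + (2 * σ) • C s) -
      (-(2 : ℝ) • (C' s * B⁻¹ * C' s) + (2 * σ) • C' s))
    (K := 2 * (K * ‖B⁻¹‖ + ‖B⁻¹‖ * K') + 2 * |σ|)
    ((hcont C hC).sub (hcont C' hC'))
    (fun s hs => ((hC s hs.1).sub (hC' s hs.1)).mono (Ici_subset_Ici.2 hs.1))
    (by simp [h0]) (fun s hs => ?_) t ⟨ht, le_rfl⟩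
  · exact sub_eq_zero.1 this
  · have hs' : s ∈ Icc 0 t := ⟨hs.1, hs.2.le⟩
    have e : (-(2 : ℝ) • (C s * B⁻¹ * C s) + (2 * σ) • C s) -
        (-(2 : ℝ) • (C' s * B⁻¹ * C' s) + (2 * σ) • C' s) =
        -(2 : ℝ) • (C s * B⁻¹ * (C s - C' s) + (C s - C' s) * (B⁻¹ * C' s)) +
          (2 * σ) • (C s - C' s) := by
      simp only [Matrix.mul_sub, Matrix.sub_mul, smul_sub, smul_add, Matrix.mul_assoc]
      abel
    have hK0 := (norm_nonneg _).trans (hK s hs')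
    have h1 : ‖C s * B⁻¹ * (C s - C' s)‖ ≤ K * ‖B⁻¹‖ * ‖C s - C' s‖ := by
      refine (norm_mul_le _ _).trans ?_
      gcongr
      exact (norm_mul_le _ _).trans (by gcongr; exact hK s hs')
    have h2 : ‖(C s - C' s) * (B⁻¹ * C' s)‖ ≤ ‖C s - C' s‖ * (‖B⁻¹‖ * K') := by
      refine (norm_mul_le _ _).trans ?_
      gcongr
      exact (norm_mul_le _ _).trans (by gcongr; exact hK' s hs')
    rw [e]
    calc _ ≤ ‖-(2 : ℝ) • (C s * B⁻¹ * (C s - C' s) + (C s - C' s) * (B⁻¹ * C' s))‖ +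
          ‖(2 * σ) • (C s - C' s)‖ := norm_add_le _ _
      _ ≤ 2 * (K * ‖B⁻¹‖ * ‖C s - C' s‖ + ‖C s - C' s‖ * (‖B⁻¹‖ * K')) +
          2 * |σ| * ‖C s - C' s‖ := by
        rw [norm_smul, norm_smul, Real.norm_eq_abs, Real.norm_eq_abs, abs_neg, abs_mul, abs_two]
        gcongr
        exact (norm_add_le _ _).trans (add_le_add h1 h2)
      _ = _ := by ring

/-- A fundamental matrix coincides with any other solution of the same linear equation that starts
at the identity and is invertible, with inverse solving the adjoint equation. -/
theorem IsFundamentalMatrix.eq_of_hasDerivAt {d : ℕ} {B : Matrix (Fin d) (Fin d) ℝ}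
    {C V W : ℝ → Matrix (Fin d) (Fin d) ℝ} {U : ℝ → ℝ → Matrix (Fin d) (Fin d) ℝ}
    (hU : IsFundamentalMatrix B C U) (hV0 : V 0 = 1)
    (hWV : ∀ t, 0 ≤ t → W t * V t = 1) (hVW : ∀ t, 0 ≤ t → V t * W t = 1)
    (hW : ∀ t, 0 ≤ t → HasDerivAt W (W t * C t * B⁻¹) t) {t : ℝ} (ht : 0 ≤ t) : U 0 t = V t := by
  have hd : ∀ s, 0 ≤ s → HasDerivWithinAt (fun s => W s * U 0 s) 0 (Ici 0) s := fun s hs => by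
    refine ((hW s hs).hasDerivWithinAt.fun_mul ((hU 0 le_rfl).2 s hs)).congr_deriv ?_
    simp [Matrix.mul_assoc]
  have hconst : W t * U 0 t = W 0 * U 0 0 :=
    constant_of_has_deriv_right_zero (f := fun s => W s * U 0 s) (a := 0) (b := t)
      (fun s hs => (hd s hs.1).continuousWithinAt.mono Icc_subset_Ici_self)
      (fun s hs => (hd s hs.1).mono (Ici_subset_Ici.2 hs.1)) t ⟨ht, le_rfl⟩
  have hW0 : W 0 = 1 := by simpa [hV0] using hWV 0 le_rfl
  rw [(hU 0 le_rfl).1, hW0, Matrix.mul_one] at hconst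
  calc U 0 t = V t * (W t * U 0 t) := by rw [← Matrix.mul_assoc, hVW t ht, Matrix.one_mul]
    _ = V t := by rw [hconst, Matrix.mul_one]

/-! ### Quadratic forms and operator norms. -/

theorem posDef_inv_matB {d K : ℕ} (G : Matrix (Fin K) (Fin d) ℝ)
    {Γ : Matrix (Fin K) (Fin K) ℝ} (hΓ : Γ.PosDef) {Γ₀ : Matrix (Fin d) (Fin d) ℝ}
    (hΓ₀ : Γ₀.PosDef) : (matB G Γ Γ₀)⁻¹.PosDef := by
  refine Matrix.PosDef.inv (Matrix.PosDef.inv (hΓ₀.inv.add_posSemidef ?_))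
  have := hΓ.inv.posSemidef.conjTranspose_mul_mul_same G
  rwa [conjTranspose_eq_transpose_of_trivial] at this

theorem dotProduct_self_eq_norm_sq {d : ℕ} (x : Fin d → ℝ) :
    x ⬝ᵥ x = ‖WithLp.toLp 2 x‖ ^ 2 := by
  rw [← real_inner_self_eq_norm_sq, EuclideanSpace.inner_toLp_toLp, star_trivial]

/-- For positive definite `A`, the identity is bounded by `‖A⁻¹‖ A`. -/
theorem dotProduct_self_le_norm_inv_mul {d : ℕ} {A : Matrix (Fin d) (Fin d) ℝ} (hA : A.PosDef)
    (x : Fin d → ℝ) : x ⬝ᵥ x ≤ ‖A⁻¹‖ * (x ⬝ᵥ A *ᵥ x) := by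
  obtain ⟨S, S', -, hS, hS', rfl, -⟩ := exists_simultaneous_diagonalization hA hA.posSemidef
  have hinv : (Sᵀ * S)⁻¹ = S' * S'ᵀ := by
    refine Matrix.inv_eq_left_inv ?_
    rw [Matrix.mul_assoc, ← Matrix.mul_assoc S'ᵀ, ← transpose_mul, hS, transpose_one,
      Matrix.one_mul, hS']
  -- By the C*-identity. As `x = S' (S x)` and `|S x|²` is the quadratic form of `A`, the bound
  -- follows.
  have hnorm : ‖(Sᵀ * S)⁻¹‖ = ‖S'‖ ^ 2 := by
    have := l2_opNorm_conjTranspose_mul_self S'ᵀ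
    rw [← conjTranspose_eq_transpose_of_trivial, conjTranspose_conjTranspose,
      l2_opNorm_conjTranspose, conjTranspose_eq_transpose_of_trivial] at this
    rw [hinv, this, sq]
  have hx : x = S' *ᵥ (S *ᵥ x) := by rw [mulVec_mulVec, hS', one_mulVec]
  have hq : x ⬝ᵥ (Sᵀ * S) *ᵥ x = ‖WithLp.toLp 2 (S *ᵥ x)‖ ^ 2 := by
    rw [← mulVec_mulVec, dotProduct_mulVec, vecMul_transpose, dotProduct_self_eq_norm_sq]
  rw [hnorm, hq, ← mul_pow, dotProduct_self_eq_norm_sq]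
  conv_lhs => rw [hx]
  gcongr
  exact l2_opNorm_mulVec S' (WithLp.toLp 2 (S *ᵥ x))

theorem dotProduct_mulVec_le_norm_mul {d : ℕ} (A : Matrix (Fin d) (Fin d) ℝ)
    (x : Fin d → ℝ) : x ⬝ᵥ A *ᵥ x ≤ ‖A‖ * (x ⬝ᵥ x) := by
  have h1 := l2_opNorm_mulVec A (WithLp.toLp 2 x)
  have h2 := real_inner_le_norm (WithLp.toLp 2 (A *ᵥ x)) (WithLp.toLp 2 x)
  rw [EuclideanSpace.inner_toLp_toLp, star_trivial] at h2
  rw [dotProduct_self_eq_norm_sq, sq, ← mul_assoc]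
  exact h2.trans (mul_le_mul_of_nonneg_right h1 (norm_nonneg _))

/-- The quadratic form of `V * Vᵀ` is `|Vᵀ x|²`, and `V` and `Vᵀ` have the same norm. -/
theorem norm_le_of_dotProduct_mul_transpose_le {d : ℕ} {V : Matrix (Fin d) (Fin d) ℝ} {c : ℝ}
    (h : ∀ x : Fin d → ℝ, x ⬝ᵥ (V * Vᵀ) *ᵥ x ≤ c * (x ⬝ᵥ x)) : ‖V‖ ≤ Real.sqrt c := by
  rw [← l2_opNorm_conjTranspose, conjTranspose_eq_transpose_of_trivial, l2_opNorm_def]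
  refine ContinuousLinearMap.opNorm_le_bound _ (Real.sqrt_nonneg c) fun x => ?_
  have hx := h x.ofLp
  rw [← mulVec_mulVec, dotProduct_mulVec, ← mulVec_transpose, dotProduct_self_eq_norm_sq,
    dotProduct_self_eq_norm_sq] at hx
  have := Real.sqrt_le_sqrt hx
  rwa [Real.sqrt_mul' c (sq_nonneg _), Real.sqrt_sq (norm_nonneg _),
    Real.sqrt_sq (norm_nonneg _)] at this

/-- The flow of `δ' = -C(t) B⁻¹ δ` for a solution `C` of the Riccati equation. -/
theorem IsRiccatiSolution.exists_flow {d : ℕ} {σ : ℝ} {B : Matrix (Fin d) (Fin d) ℝ}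
    {C : ℝ → Matrix (Fin d) (Fin d) ℝ} (hC : IsRiccatiSolution σ B C) (hB : B⁻¹.PosDef)
    (h0 : (C 0).PosSemidef) :
    ∃ V W : ℝ → Matrix (Fin d) (Fin d) ℝ, V 0 = 1 ∧ ∀ t : ℝ, 0 ≤ t →
      W t * V t = 1 ∧ V t * W t = 1 ∧
      HasDerivAt W (W t * C t * B⁻¹) t ∧
      C t = Real.exp (2 * σ * t) • (V t * C 0 * (V t)ᵀ) ∧
      ∀ M : ℝ, max ‖C 0‖ ‖B‖ ≤ M → ∀ x : Fin d → ℝ,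
        x ⬝ᵥ (V t * C 0 * (V t)ᵀ) *ᵥ x ≤ M / (1 + 2 * expPrimitive σ t) * (x ⬝ᵥ x) := by
  obtain ⟨V, W, C', hV, hC'0, hall⟩ := exists_riccati_flow σ hB h0
  have hC' : IsRiccatiSolution σ B C' := fun t ht => (hall t ht).2.2.2.2.1.hasDerivWithinAt
  have hBB : B⁻¹⁻¹ = B := by
    refine Matrix.nonsing_inv_nonsing_inv B ?_
    rw [← Matrix.isUnit_nonsing_inv_det_iff]
    exact (Matrix.isUnit_iff_isUnit_det _).1 hB.isUnit
  refine ⟨V, W, hV, fun t ht => ?_⟩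
  have hCt : C t = C' t := hC.eqOn hC' hC'0.symm ht
  obtain ⟨h1, h2, -, h4, -, h6, h7⟩ := hall t ht
  refine ⟨h1, h2, hCt ▸ h4, hCt ▸ h6, fun M hM x => h7 M x ?_ ?_⟩
  · exact (dotProduct_mulVec_le_norm_mul _ _).trans
      (mul_le_mul_of_nonneg_right ((le_max_left _ _).trans hM) (dotProduct_self_eq_norm_sq x ▸
        sq_nonneg _))
  · rw [hBB]
    exact (dotProduct_mulVec_le_norm_mul _ _).trans
      (mul_le_mul_of_nonneg_right ((le_max_right _ _).trans hM) (dotProduct_self_eq_norm_sq x ▸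
        sq_nonneg _))

/-- Positive definiteness gives `1 ≤ m A`, hence `V Vᵀ ≤ m V A Vᵀ ≤ m M / (1 + 2 ∫₀ᵗ exp (2σs) ds)`.
By `alpha_eq` the square root of the last constant is the stated rate. -/
theorem norm_le_of_riccati_flow {d : ℕ} {σ t m M : ℝ} {A V : Matrix (Fin d) (Fin d) ℝ}
    (hA : A.PosDef) (hm : ‖A⁻¹‖ ≤ m)
    (hV : ∀ x : Fin d → ℝ,
      x ⬝ᵥ (V * A * Vᵀ) *ᵥ x ≤ M / (1 + 2 * expPrimitive σ t) * (x ⬝ᵥ x)) (ht : 0 ≤ t) (hM : 0 ≤ M) :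
    ‖V‖ ≤ Real.sqrt (m * M) * (Real.exp (-σ * t) / Real.sqrt (alpha σ t)) := by
  have hm0 : 0 ≤ m := (norm_nonneg _).trans hm
  have hb := expPrimitive_nonneg σ ht
  have h1 : Real.sqrt (m * M) * (Real.exp (-σ * t) / Real.sqrt (alpha σ t)) =
      Real.sqrt (m * (M / (1 + 2 * expPrimitive σ t))) := by
    have he : Real.exp (-2 * σ * t) = Real.exp (-σ * t) ^ 2 := by
      rw [← Real.exp_nat_mul]; push_cast; ring_nf
    rw [alpha_eq, he, Real.sqrt_mul (sq_nonneg _), Real.sqrt_sq (Real.exp_pos _).le,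
      ← mul_div_assoc m, Real.sqrt_div (by positivity)]
    have := Real.exp_pos (-σ * t)
    have : 0 < Real.sqrt (1 + 2 * expPrimitive σ t) := Real.sqrt_pos.2 (by positivity)
    field_simp
  rw [h1]
  refine norm_le_of_dotProduct_mul_transpose_le fun x => ?_
  have h2 := dotProduct_self_le_norm_inv_mul hA (Vᵀ *ᵥ x)
  have h3 := hA.posSemidef.dotProduct_mulVec_nonneg (Vᵀ *ᵥ x)
  have h4 : x ⬝ᵥ (V * A * Vᵀ) *ᵥ x = (Vᵀ *ᵥ x) ⬝ᵥ A *ᵥ (Vᵀ *ᵥ x) := by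
    rw [← mulVec_mulVec, ← mulVec_mulVec, dotProduct_mulVec, ← mulVec_transpose]
  rw [star_trivial] at h3
  rw [← mulVec_mulVec, dotProduct_mulVec, ← mulVec_transpose, mul_assoc]
  refine h2.trans ((mul_le_mul_of_nonneg_right hm h3).trans ?_)
  rw [← h4]
  exact mul_le_mul_of_nonneg_left (hV x) hm0

/-! ### Time-dependent test functions in the weak equation. -/

open Filter Topology in
/-- Integrals of a jointly continuous family of functions with a common compact support against a
narrowly continuous family of probability measures depend continuously on the parameter. -/
theorem continuousOn_integral_of_compactSupport {X E : Type*} [TopologicalSpace X]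
    [TopologicalSpace E] [MeasurableSpace E] [OpensMeasurableSpace E] [R1Space E]
    {S : Set X} {K : Set E} (hK : IsCompact K) {g : X → E → ℝ}
    (hg : ContinuousOn (Function.uncurry g) (S ×ˢ univ)) (hg0 : ∀ x ∈ S, ∀ u ∉ K, g x u = 0)
    {f : X → ProbabilityMeasure E} (hf : ContinuousOn f S) :
    ContinuousOn (fun x => ∫ u, g x u ∂(f x : Measure E)) S := by
  intro x₀ hx₀
  have hgc : ∀ x ∈ S, Continuous (g x) := fun x hx =>
    hg.comp_continuous (f := fun u => (x, u)) (by fun_prop) fun u => ⟨hx, mem_univ u⟩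
  have hsupp : ∀ x ∈ S, HasCompactSupport (g x) := fun x hx =>
    HasCompactSupport.intro hK (hg0 x hx)
  have hint : ∀ x ∈ S, ∀ y, Integrable (g x) (f y : Measure E) := fun x hx y =>
    (hgc x hx).integrable_of_hasCompactSupport (hsupp x hx)
  obtain ⟨b, hb⟩ := (hsupp x₀ hx₀).exists_bound_of_continuous (hgc x₀ hx₀)
  have h1 : Tendsto (fun x => ∫ u, g x₀ u ∂(f x : Measure E)) (𝓝[S] x₀)
      (𝓝 (∫ u, g x₀ u ∂(f x₀ : Measure E))) :=
    ProbabilityMeasure.tendsto_iff_forall_integral_tendsto.1 (hf x₀ hx₀)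
      (BoundedContinuousFunction.ofNormedAddCommGroup (g x₀) (hgc x₀ hx₀) b hb)
  -- Compactness of `K` makes `g x → g x₀` uniform, and all masses are one. Narrow convergence is
  -- then needed only for the fixed function `g x₀`.
  have h2 : Tendsto (fun x => ∫ u, (g x u - g x₀ u) ∂(f x : Measure E)) (𝓝[S] x₀) (𝓝 0) := by
    rw [Metric.tendsto_nhds]
    intro ε hε
    obtain ⟨v, hv, hvK⟩ := hK.mem_uniformity_of_prod (f := g) (s := S) (q := x₀)
      (hg.mono (prod_mono_right (subset_univ K))) hx₀ (Metric.dist_mem_uniformity (half_pos hε))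
    filter_upwards [hv, self_mem_nhdsWithin] with x hxv hxS
    rw [dist_zero_right]
    refine (norm_integral_le_of_norm_le_const (C := ε / 2) (Eventually.of_forall fun u => ?_)).trans_lt ?_
    · by_cases hu : u ∈ K
      · exact (hvK x hxv u hu).le
      · rw [hg0 x hxS u hu, hg0 x₀ hx₀ u hu, sub_zero, norm_zero]
        exact (half_pos hε).le
    · simp [hε]
  have h3 := h2.add h1
  rw [zero_add] at h3
  refine h3.congr' ?_
  filter_upwards [self_mem_nhdsWithin] with x hx
  rw [integral_sub (hint x hx x) (hint x₀ hx₀ x), sub_add_cancel]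

-- The integrand also moves with `t`, but the interval has length zero at `t = r`. That motion is
-- therefore of higher order, and continuity of `k` at the diagonal point replaces differentiability
-- in `t`.
open Filter Topology in
theorem hasDerivAt_integral_of_continuousAt {k : ℝ → ℝ → ℝ} {r : ℝ}
    (hk : ContinuousAt (Function.uncurry k) (r, r))
    (hint : ∀ᶠ t in 𝓝 r, IntervalIntegrable (fun q => k q t) volume r t) :
    HasDerivAt (fun t => ∫ q in r..t, k q t) (k r r) r := by
  rw [hasDerivAt_iff_isLittleO, Asymptotics.isLittleO_iff]
  intro ε hε
  obtain ⟨δ, hδ, hball⟩ := Metric.continuousAt_iff.1 hk ε hε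
  filter_upwards [hint, Metric.ball_mem_nhds r hδ] with t ht htδ
  have h1 : ∀ q ∈ uIoc r t, ‖k q t - k r r‖ ≤ ε := fun q hq => by
    have hq' : dist q r ≤ dist t r := by
      rw [Real.dist_eq, Real.dist_eq]
      exact abs_sub_left_of_mem_uIcc (uIoc_subset_uIcc hq)
    refine (hball (x := (q, t)) ?_).le
    rw [Prod.dist_eq]
    exact max_lt (hq'.trans_lt htδ) htδ
  have h2 := intervalIntegral.norm_integral_le_of_norm_le_const h1
  rw [intervalIntegral.integral_sub ht (by simp), intervalIntegral.integral_const] at h2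
  simpa using h2

open Filter Topology in
/-- Evolution of the integral of a time-dependent compactly supported test function along a
narrowly continuous curve of probability measures which solves a weak equation: here
`L q s` is the generator at time `q` applied to the test function `φ s`. -/
theorem integral_sub_integral_of_weak_equation {E : Type*} [TopologicalSpace E]
    [R1Space E] [MeasurableSpace E] [OpensMeasurableSpace E] {K : Set E} (hK : IsCompact K)
    {f : ℝ → ProbabilityMeasure E} (hf : ContinuousOn f (Ici 0))
    {φ ψ : ℝ → E → ℝ} {L : ℝ → ℝ → E → ℝ}
    (hφ : ContinuousOn (Function.uncurry φ) (Ici 0 ×ˢ univ))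
    (hψ : ContinuousOn (Function.uncurry ψ) (Ici 0 ×ˢ univ))
    (hL : ContinuousOn (Function.uncurry fun x : ℝ × ℝ => L x.1 x.2)
      ((Ici 0 ×ˢ Ici 0) ×ˢ univ))
    (hφ0 : ∀ s, ∀ u ∉ K, φ s u = 0) (hψ0 : ∀ s, ∀ u ∉ K, ψ s u = 0)
    (hL0 : ∀ q s, ∀ u ∉ K, L q s u = 0)
    (hderiv : ∀ s, 0 < s → ∀ u, HasDerivAt (fun s => φ s u) (ψ s u) s)
    (hweak : ∀ s t, 0 ≤ s → 0 ≤ t → ∫ u, φ s u ∂(f t : Measure E) =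
      ∫ u, φ s u ∂(f 0 : Measure E) + ∫ q in (0 : ℝ)..t, ∫ u, L q s u ∂(f q : Measure E))
    {T : ℝ} (hT : 0 ≤ T) :
    ContinuousOn (fun s => ∫ u, (ψ s u + L s s u) ∂(f s : Measure E)) (Ici 0) ∧
    ∫ s in (0 : ℝ)..T, ∫ u, (ψ s u + L s s u) ∂(f s : Measure E) =
      ∫ u, φ T u ∂(f T : Measure E) - ∫ u, φ 0 u ∂(f 0 : Measure E) := by
  set k : ℝ → ℝ → ℝ := fun q s => ∫ u, L q s u ∂(f q : Measure E) with hk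
  have hkc : ContinuousOn (Function.uncurry k) (Ici 0 ×ˢ Ici 0) :=
    continuousOn_integral_of_compactSupport (g := fun x : ℝ × ℝ => L x.1 x.2)
      (f := fun x : ℝ × ℝ => f x.1) hK hL
      (fun x _ => hL0 x.1 x.2) (hf.comp continuousOn_fst fun x hx => hx.1)
  have hLd : ContinuousOn (Function.uncurry fun s => L s s) (Ici 0 ×ˢ univ) :=
    hL.comp (f := fun x : ℝ × E => ((x.1, x.1), x.2)) (by fun_prop) fun x hx => ⟨⟨hx.1, hx.1⟩, hx.2⟩
  have hc1 : ContinuousOn (fun s => ∫ u, (ψ s u + L s s u) ∂(f s : Measure E)) (Ici 0) :=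
    continuousOn_integral_of_compactSupport (g := fun s u => ψ s u + L s s u) hK (hψ.add hLd)
      (fun s _ u hu => by simp only [hψ0 s u hu, hL0 s s u hu, add_zero]) hf
  refine ⟨hc1, ?_⟩
  have hc2 : ContinuousOn (fun s => ∫ u, φ s u ∂(f s : Measure E)) (Ici 0) :=
    continuousOn_integral_of_compactSupport hK hφ (fun s _ => hφ0 s) hf
  have hsub : uIcc 0 T ⊆ Ici 0 := by rw [uIcc_of_le hT]; exact Icc_subset_Ici_self
  have hslice : ∀ g : ℝ → E → ℝ, ContinuousOn (Function.uncurry g) (Ici 0 ×ˢ univ) →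
      ∀ s, 0 ≤ s → Continuous (g s) := fun g hg s hs =>
    hg.comp_continuous (f := fun u => (s, u)) (by fun_prop) fun u => ⟨hs, mem_univ u⟩
  have hintg : ∀ g : ℝ → E → ℝ, ContinuousOn (Function.uncurry g) (Ici 0 ×ˢ univ) →
      (∀ s, ∀ u ∉ K, g s u = 0) → ∀ s t, 0 ≤ s → Integrable (g s) (f t : Measure E) :=
    fun g hg hg0 s t hs =>
      (hslice g hg s hs).integrable_of_hasCompactSupport (HasCompactSupport.intro hK (hg0 s))
  refine intervalIntegral.integral_eq_sub_of_hasDerivAt_of_le hT (hc2.mono Icc_subset_Ici_self)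
    (fun r hr => ?_) (hc1.mono hsub).intervalIntegrable
  have hr0 : 0 < r := hr.1
  have hkint : ∀ a b t, 0 ≤ a → 0 ≤ b → 0 ≤ t →
      IntervalIntegrable (fun q => k q t) volume a b := fun a b t ha hb ht => by
    refine ContinuousOn.intervalIntegrable ?_
    refine hkc.comp (f := fun q : ℝ => (q, t)) (by fun_prop) fun q hq => ⟨?_, ht⟩
    exact (le_min ha hb).trans hq.1
  have hpos : ∀ᶠ t in 𝓝 r, 0 < t := lt_mem_nhds hr0
  have h1 : HasDerivAt (fun t => ∫ q in r..t, k q t) (k r r) r := by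
    refine hasDerivAt_integral_of_continuousAt
      (hkc.continuousAt (prod_mem_nhds (Ici_mem_nhds hr0) (Ici_mem_nhds hr0))) ?_
    filter_upwards [hpos] with t ht using hkint r t t hr0.le ht.le ht.le
  have h2 : HasDerivAt (fun t => ∫ u, φ t u ∂(f r : Measure E))
      (∫ u, ψ r u ∂(f r : Measure E)) r := by
    obtain ⟨b, hb⟩ := (isCompact_Icc (a := r / 2) (b := 2 * r)).prod hK |>.exists_bound_of_continuousOn
      (hψ.mono (prod_mono (fun s hs => (half_pos hr0).le.trans hs.1) (subset_univ K)))
    refine (hasDerivAt_integral_of_dominated_loc_of_deriv_le (bound := fun _ => max b 0)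
      (s := Icc (r / 2) (2 * r)) (Icc_mem_nhds (by linarith) (by linarith)) ?_
      (hintg φ hφ hφ0 r r hr0.le) (hintg ψ hψ hψ0 r r hr0.le).aestronglyMeasurable
      (Eventually.of_forall fun u s hs => ?_) (integrable_const _)
      (Eventually.of_forall fun u s hs => hderiv s ((half_pos hr0).trans_le hs.1) u)).2
    · filter_upwards [hpos] with t ht using (hintg φ hφ hφ0 t r ht.le).aestronglyMeasurable
    · by_cases hu : u ∈ K
      · exact (hb (s, u) ⟨hs, hu⟩).trans (le_max_left _ _)
      · rw [hψ0 s u hu, norm_zero]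
        exact le_max_right _ _
  have h3 : HasDerivAt (fun s => ∫ u, φ s u ∂(f s : Measure E))
      (∫ u, ψ r u ∂(f r : Measure E) + k r r) r := by
    -- Subtracting the weak equation for the fixed test function `φ t` at times `t` and `r` gives `∫
    -- φ t ∂(f t) = ∫ φ t ∂(f r) + ∫ q in r..t, k q t`, and the two terms are differentiated
    -- separately.
    refine (h2.add h1).congr_of_eventuallyEq ?_
    filter_upwards [hpos] with t ht
    have e1 := hweak t t ht.le ht.le
    have e2 := hweak t r ht.le hr0.le
    have e3 := intervalIntegral.integral_add_adjacent_intervals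
      (hkint 0 r t le_rfl hr0.le ht.le) (hkint r t t hr0.le ht.le ht.le)
    simp only [Pi.add_apply]
    change _ = _ + ∫ q in (0 : ℝ)..t, k q t at e1
    change _ = _ + ∫ q in (0 : ℝ)..r, k q t at e2
    linarith
  rwa [integral_add (hintg ψ hψ hψ0 r r hr0.le)
    (hintg (fun s => L s s) hLd (fun s => hL0 s s) r r hr0.le)]

/-! ### Cut off plane waves and the generator. -/

/-- A plane wave `cos(⟪ζ, u - u₀⟫ + θ)` cut off at scale `ρ⁻¹`. -/
noncomputable def cutoffWave {d : ℕ} (χ : EuclideanSpace ℝ (Fin d) → ℝ)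
    (u₀ : EuclideanSpace ℝ (Fin d)) (θ ρ : ℝ) (ζ u : EuclideanSpace ℝ (Fin d)) : ℝ :=
  χ (ρ • (u - u₀)) * Real.cos (inner ℝ ζ (u - u₀) + θ)

section

variable {d : ℕ} {χ : EuclideanSpace ℝ (Fin d) → ℝ} (u₀ : EuclideanSpace ℝ (Fin d))
  (θ ρ : ℝ) (ζ u w w' : EuclideanSpace ℝ (Fin d))

theorem contDiff_cutoffWave (hχ : ContDiff ℝ ∞ χ) : ContDiff ℝ ∞ (cutoffWave χ u₀ θ ρ ζ) := by
  unfold cutoffWave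
  refine ContDiff.mul (hχ.comp (by fun_prop)) (Real.contDiff_cos.comp ?_)
  exact (contDiff_const.inner ℝ (contDiff_id.sub contDiff_const)).add contDiff_const

theorem fderiv_cutoffWave (hχ : ContDiff ℝ ∞ χ) :
    fderiv ℝ (cutoffWave χ u₀ θ ρ ζ) u w =
      ρ * fderiv ℝ χ (ρ • (u - u₀)) w * Real.cos (inner ℝ ζ (u - u₀) + θ) -
        χ (ρ • (u - u₀)) * (Real.sin (inner ℝ ζ (u - u₀) + θ) * inner ℝ ζ w) := by
  have h1 : HasFDerivAt (fun u => χ (ρ • (u - u₀)))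
      ((fderiv ℝ χ (ρ • (u - u₀))).comp (ρ • ContinuousLinearMap.id ℝ _)) u :=
    ((hχ.differentiable (by simp)) _).hasFDerivAt.comp u
      (((hasFDerivAt_id u).sub_const u₀).const_smul ρ)
  have h2 : HasFDerivAt (fun u => inner ℝ ζ (u - u₀) + θ) (innerSL ℝ ζ) u := by
    have := ((innerSL ℝ ζ).hasFDerivAt (x := u - u₀)).comp u ((hasFDerivAt_id u).sub_const u₀)
    exact this.add_const θ
  have h3 := (h1.mul h2.cos).fderiv
  change fderiv ℝ (cutoffWave χ u₀ θ ρ ζ) u = _ at h3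
  rw [h3]
  simp
  ring

theorem fderiv_fderiv_cutoffWave (hχ : ContDiff ℝ ∞ χ) :
    fderiv ℝ (fderiv ℝ (cutoffWave χ u₀ θ ρ ζ)) u w w' =
      (ρ ^ 2 * fderiv ℝ (fderiv ℝ χ) (ρ • (u - u₀)) w w' -
        χ (ρ • (u - u₀)) * (inner ℝ ζ w * inner ℝ ζ w')) * Real.cos (inner ℝ ζ (u - u₀) + θ) -
      ρ * (fderiv ℝ χ (ρ • (u - u₀)) w * inner ℝ ζ w' +
        fderiv ℝ χ (ρ • (u - u₀)) w' * inner ℝ ζ w) *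
          Real.sin (inner ℝ ζ (u - u₀) + θ) := by
  have hχ' : Differentiable ℝ (fderiv ℝ χ) :=
    (hχ.fderiv_right (m := ∞) (by simp)).differentiable (by simp)
  have h0 : Differentiable ℝ (fderiv ℝ (cutoffWave χ u₀ θ ρ ζ)) :=
    ((contDiff_cutoffWave u₀ θ ρ ζ hχ).fderiv_right (m := ∞) (by simp)).differentiable (by simp)
  have hz : HasFDerivAt (fun u => ρ • (u - u₀)) (ρ • ContinuousLinearMap.id ℝ _) u :=
    ((hasFDerivAt_id u).sub_const u₀).const_smul ρ
  have h1 : HasFDerivAt (fun u => χ (ρ • (u - u₀)))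
      ((fderiv ℝ χ (ρ • (u - u₀))).comp (ρ • ContinuousLinearMap.id ℝ _)) u :=
    ((hχ.differentiable (by simp)) _).hasFDerivAt.comp u hz
  have h2 : HasFDerivAt (fun u => inner ℝ ζ (u - u₀) + θ) (innerSL ℝ ζ) u := by
    have := ((innerSL ℝ ζ).hasFDerivAt (x := u - u₀)).comp u ((hasFDerivAt_id u).sub_const u₀)
    exact this.add_const θ
  have h4 : HasFDerivAt (fun u => fderiv ℝ χ (ρ • (u - u₀)) w')
      (((ContinuousLinearMap.apply ℝ ℝ w').comp (fderiv ℝ (fderiv ℝ χ) (ρ • (u - u₀)))).comp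
        (ρ • ContinuousLinearMap.id ℝ _)) u :=
    ((ContinuousLinearMap.apply ℝ ℝ w').hasFDerivAt.comp _ (hχ' _).hasFDerivAt).comp u hz
  have h5 : (fun u => fderiv ℝ (cutoffWave χ u₀ θ ρ ζ) u w') = fun u =>
      ρ * fderiv ℝ χ (ρ • (u - u₀)) w' * Real.cos (inner ℝ ζ (u - u₀) + θ) -
        χ (ρ • (u - u₀)) * (Real.sin (inner ℝ ζ (u - u₀) + θ) * inner ℝ ζ w') :=
    funext fun u => fderiv_cutoffWave u₀ θ ρ ζ u w' hχ
  have h6 : fderiv ℝ (fderiv ℝ (cutoffWave χ u₀ θ ρ ζ)) u w w' =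
      fderiv ℝ (fun u => fderiv ℝ (cutoffWave χ u₀ θ ρ ζ) u w') u w := by
    have := ((ContinuousLinearMap.apply ℝ ℝ w').hasFDerivAt.comp u (h0 u).hasFDerivAt).fderiv
    change fderiv ℝ (fun u => fderiv ℝ (cutoffWave χ u₀ θ ρ ζ) u w') u = _ at this
    rw [this]
    rfl
  rw [h6, h5, (((h4.const_mul ρ).fun_mul h2.cos).fun_sub
    (h1.fun_mul (h2.sin.mul_const (inner ℝ ζ w')))).fderiv]
  simp
  ring

end

/-- The part of the generator, applied to a cut off plane wave, which is due to the cutoff and is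
in phase with the wave. -/
noncomputable def cutoffErrorCos {d : ℕ} (χ : EuclideanSpace ℝ (Fin d) → ℝ) (σ : ℝ)
    (P A : Matrix (Fin d) (Fin d) ℝ) (ρ : ℝ) (z : EuclideanSpace ℝ (Fin d)) : ℝ :=
  σ * ρ ^ 2 * (∑ i, ∑ j, A i j * fderiv ℝ (fderiv ℝ χ) z (EuclideanSpace.single i 1)
    (EuclideanSpace.single j 1)) - fderiv ℝ χ z (toEuclideanLin (A * P) z)

/-- The part of the generator, applied to a cut off plane wave, which is due to the cutoff and is
out of phase with the wave. -/
noncomputable def cutoffErrorSin {d : ℕ} (χ : EuclideanSpace ℝ (Fin d) → ℝ) (σ : ℝ)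
    (A : Matrix (Fin d) (Fin d) ℝ) (ζ : EuclideanSpace ℝ (Fin d)) (ρ : ℝ)
    (z : EuclideanSpace ℝ (Fin d)) : ℝ :=
  σ * ρ * ∑ i, ∑ j, A i j * (fderiv ℝ χ z (EuclideanSpace.single i 1) * ζ j +
    fderiv ℝ χ z (EuclideanSpace.single j 1) * ζ i)

/-- The last bracket is the generator on the uncut wave, to be cancelled by the time derivative of
amplitude and frequency. The remaining terms contain derivatives of `χ`. There the factor `ρ` from
the chain rule is absorbed by the linear drift, which becomes a function of `z = ρ • (u - u₀)`
alone. -/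
theorem adjointOperator_cutoffWave {d : ℕ} {χ : EuclideanSpace ℝ (Fin d) → ℝ}
    (hχ : ContDiff ℝ ∞ χ) (σ : ℝ) (B A : Matrix (Fin d) (Fin d) ℝ)
    (u₀ : EuclideanSpace ℝ (Fin d)) (a θ ρ : ℝ) (ζ u : EuclideanSpace ℝ (Fin d)) :
    adjointOperator σ B u₀ A (fun u => a * cutoffWave χ u₀ θ ρ ζ u) u =
      a * (Real.cos (inner ℝ ζ (u - u₀) + θ) * cutoffErrorCos χ σ B⁻¹ A ρ (ρ • (u - u₀)) -
        Real.sin (inner ℝ ζ (u - u₀) + θ) * cutoffErrorSin χ σ A ζ ρ (ρ • (u - u₀))) -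
      a * χ (ρ • (u - u₀)) * (σ * (ζ.ofLp ⬝ᵥ A *ᵥ ζ.ofLp) * Real.cos (inner ℝ ζ (u - u₀) + θ) -
        Real.sin (inner ℝ ζ (u - u₀) + θ) * inner ℝ ζ (toEuclideanLin (A * B⁻¹) (u - u₀))) := by
  have hd : fderiv ℝ (fun u => a * cutoffWave χ u₀ θ ρ ζ u) =
      fun u => a • fderiv ℝ (cutoffWave χ u₀ θ ρ ζ) u :=
    funext fun u => fderiv_const_mul
      ((contDiff_cutoffWave u₀ θ ρ ζ hχ).differentiable (by simp) u) a
  have hd2 : fderiv ℝ (fun u => a • fderiv ℝ (cutoffWave χ u₀ θ ρ ζ) u) u =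
      a • fderiv ℝ (fderiv ℝ (cutoffWave χ u₀ θ ρ ζ)) u :=
    fderiv_fun_const_smul (((contDiff_cutoffWave u₀ θ ρ ζ hχ).fderiv_right
      (m := ∞) (by simp)).differentiable (by simp) u) a
  have hquad : ζ.ofLp ⬝ᵥ A *ᵥ ζ.ofLp = ∑ i, ∑ j, A i j * (ζ i * ζ j) := by
    simp only [dotProduct, mulVec, Finset.mul_sum]
    exact Finset.sum_congr rfl fun i _ => Finset.sum_congr rfl fun j _ => by ring
  have hsingle : ∀ i, inner ℝ ζ (EuclideanSpace.single i (1 : ℝ)) = ζ i := fun i => by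
    simp [EuclideanSpace.inner_single_right]
  unfold adjointOperator
  rw [hd, hd2]
  simp only [_root_.smul_apply, fderiv_fderiv_cutoffWave _ _ _ _ _ _ _ hχ,
    fderiv_cutoffWave _ _ _ _ _ _ hχ, hsingle, smul_eq_mul, hquad, cutoffErrorCos, cutoffErrorSin,
    map_smul]
  set c := Real.cos (inner ℝ ζ (u - u₀) + θ)
  set s := Real.sin (inner ℝ ζ (u - u₀) + θ)
  set z := ρ • (u - u₀)
  have hsum : ∀ x y w : Fin d → Fin d → ℝ, ∑ i, ∑ j, A i j * (a * ((ρ ^ 2 * x i j - χ z * w i j) * c -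
      ρ * y i j * s)) = a * (ρ ^ 2 * c * ∑ i, ∑ j, A i j * x i j - χ z * c * ∑ i, ∑ j, A i j * w i j -
        ρ * s * ∑ i, ∑ j, A i j * y i j) := fun x y w => by
    simp only [Finset.mul_sum, ← Finset.sum_sub_distrib]
    exact Finset.sum_congr rfl fun i _ => Finset.sum_congr rfl fun j _ => by ring
  rw [hsum]
  ring

theorem continuous_cutoffErrorCos {d : ℕ} {χ : EuclideanSpace ℝ (Fin d) → ℝ}
    (hχ : ContDiff ℝ ∞ χ) (σ : ℝ) (P : Matrix (Fin d) (Fin d) ℝ) :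
    Continuous fun x : Matrix (Fin d) (Fin d) ℝ × ℝ × EuclideanSpace ℝ (Fin d) =>
      cutoffErrorCos χ σ P x.1 x.2.1 x.2.2 := by
  have h1 : Continuous (fderiv ℝ χ) := hχ.continuous_fderiv (by simp)
  have h2 : Continuous (fderiv ℝ (fderiv ℝ χ)) :=
    (hχ.fderiv_right (m := ∞) (by simp)).continuous_fderiv (by simp)
  have h3 : Continuous fun x : Matrix (Fin d) (Fin d) ℝ × ℝ × EuclideanSpace ℝ (Fin d) =>
      toEuclideanLin (x.1 * P) x.2.2 := by
    simp only [toLpLin_apply]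
    fun_prop
  unfold cutoffErrorCos
  fun_prop

theorem continuous_cutoffErrorSin {d : ℕ} {χ : EuclideanSpace ℝ (Fin d) → ℝ}
    (hχ : ContDiff ℝ ∞ χ) (σ : ℝ) :
    Continuous fun x : Matrix (Fin d) (Fin d) ℝ × EuclideanSpace ℝ (Fin d) × ℝ ×
      EuclideanSpace ℝ (Fin d) => cutoffErrorSin χ σ x.1 x.2.1 x.2.2.1 x.2.2.2 := by
  have h1 : Continuous (fderiv ℝ χ) := hχ.continuous_fderiv (by simp)
  unfold cutoffErrorSin
  fun_prop

theorem fderiv_eq_zero_of_notMem_tsupport {E F : Type*} [NormedAddCommGroup E] [NormedSpace ℝ E]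
    [NormedAddCommGroup F] [NormedSpace ℝ F] {χ : E → F} {z : E} (hz : z ∉ tsupport χ) :
    fderiv ℝ χ z = 0 :=
  image_eq_zero_of_notMem_tsupport fun h => hz (tsupport_fderiv_subset ℝ h)

theorem cutoffErrorCos_eq_zero {d : ℕ} {χ : EuclideanSpace ℝ (Fin d) → ℝ} (σ : ℝ)
    (P A : Matrix (Fin d) (Fin d) ℝ) (ρ : ℝ) {z : EuclideanSpace ℝ (Fin d)}
    (hz : z ∉ tsupport χ) : cutoffErrorCos χ σ P A ρ z = 0 := by
  have h1 : fderiv ℝ (fderiv ℝ χ) z = 0 :=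
    fderiv_eq_zero_of_notMem_tsupport fun h => hz (tsupport_fderiv_subset ℝ h)
  simp [cutoffErrorCos, h1, fderiv_eq_zero_of_notMem_tsupport hz]

theorem cutoffErrorSin_eq_zero {d : ℕ} {χ : EuclideanSpace ℝ (Fin d) → ℝ} (σ : ℝ)
    (A : Matrix (Fin d) (Fin d) ℝ) (ζ : EuclideanSpace ℝ (Fin d)) (ρ : ℝ)
    {z : EuclideanSpace ℝ (Fin d)} (hz : z ∉ tsupport χ) :
    cutoffErrorSin χ σ A ζ ρ z = 0 := by
  simp [cutoffErrorSin, fderiv_eq_zero_of_notMem_tsupport hz]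

/-- The total contribution of the cutoff. -/
noncomputable def cutoffError {d : ℕ} (χ : EuclideanSpace ℝ (Fin d) → ℝ) (σ : ℝ)
    (P : Matrix (Fin d) (Fin d) ℝ) (u₀ : EuclideanSpace ℝ (Fin d)) (θ : ℝ)
    (A : Matrix (Fin d) (Fin d) ℝ) (a : ℝ) (ζ : EuclideanSpace ℝ (Fin d)) (ρ : ℝ)
    (u : EuclideanSpace ℝ (Fin d)) : ℝ :=
  a * (Real.cos (inner ℝ ζ (u - u₀) + θ) * cutoffErrorCos χ σ P A ρ (ρ • (u - u₀)) -
    Real.sin (inner ℝ ζ (u - u₀) + θ) * cutoffErrorSin χ σ A ζ ρ (ρ • (u - u₀)))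

section

variable {d : ℕ} {χ : EuclideanSpace ℝ (Fin d) → ℝ} (σ : ℝ)
  (P : Matrix (Fin d) (Fin d) ℝ) (u₀ : EuclideanSpace ℝ (Fin d)) (θ : ℝ)

theorem continuous_cutoffError (hχ : ContDiff ℝ ∞ χ) :
    Continuous fun x : Matrix (Fin d) (Fin d) ℝ × ℝ × EuclideanSpace ℝ (Fin d) × ℝ ×
      EuclideanSpace ℝ (Fin d) =>
      cutoffError χ σ P u₀ θ x.1 x.2.1 x.2.2.1 x.2.2.2.1 x.2.2.2.2 := by
  have h1 : Continuous fun x : Matrix (Fin d) (Fin d) ℝ × ℝ × EuclideanSpace ℝ (Fin d) × ℝ ×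
      EuclideanSpace ℝ (Fin d) =>
      cutoffErrorCos χ σ P x.1 x.2.2.2.1 (x.2.2.2.1 • (x.2.2.2.2 - u₀)) :=
    (continuous_cutoffErrorCos hχ σ P).comp
      (f := fun x : Matrix (Fin d) (Fin d) ℝ × ℝ × EuclideanSpace ℝ (Fin d) × ℝ ×
        EuclideanSpace ℝ (Fin d) => (x.1, x.2.2.2.1, x.2.2.2.1 • (x.2.2.2.2 - u₀))) (by fun_prop)
  have h2 : Continuous fun x : Matrix (Fin d) (Fin d) ℝ × ℝ × EuclideanSpace ℝ (Fin d) × ℝ ×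
      EuclideanSpace ℝ (Fin d) =>
      cutoffErrorSin χ σ x.1 x.2.2.1 x.2.2.2.1 (x.2.2.2.1 • (x.2.2.2.2 - u₀)) :=
    (continuous_cutoffErrorSin hχ σ).comp
      (f := fun x : Matrix (Fin d) (Fin d) ℝ × ℝ × EuclideanSpace ℝ (Fin d) × ℝ ×
        EuclideanSpace ℝ (Fin d) => (x.1, x.2.2.1, x.2.2.2.1, x.2.2.2.1 • (x.2.2.2.2 - u₀)))
      (by fun_prop)
  unfold cutoffError
  fun_prop

/-- At `ρ = 0` the diffusion terms carry a factor `ρ` and the drift term is evaluated at `z = 0`.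
With continuity in `ρ` this gives the pointwise limit of the error. -/
theorem cutoffError_zero_scale (A : Matrix (Fin d) (Fin d) ℝ) (a : ℝ)
    (ζ u : EuclideanSpace ℝ (Fin d)) : cutoffError χ σ P u₀ θ A a ζ 0 u = 0 := by
  simp [cutoffError, cutoffErrorCos, cutoffErrorSin]

/-- Apart from bounded trigonometric factors, `u` enters only through `z = ρ • (u - u₀)`, and the
error vanishes unless `z` lies in the compact support of `χ`. Uniformity in `u` is what makes moment
assumptions unnecessary. -/
theorem exists_bound_cutoffError (hχ : ContDiff ℝ ∞ χ) (hχc : HasCompactSupport χ)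
    {C : ℝ → Matrix (Fin d) (Fin d) ℝ} {a : ℝ → ℝ} {ζ : ℝ → EuclideanSpace ℝ (Fin d)} {T : ℝ}
    (hC : ContinuousOn C (Icc 0 T)) (ha : ContinuousOn a (Icc 0 T))
    (hζ : ContinuousOn ζ (Icc 0 T)) :
    ∃ b, ∀ s ∈ Icc 0 T, ∀ ρ ∈ Icc (0 : ℝ) 1, ∀ u,
      ‖cutoffError χ σ P u₀ θ (C s) (a s) (ζ s) ρ u‖ ≤ b := by
  have hcomp : IsCompact (Icc 0 T ×ˢ Icc (0 : ℝ) 1 ×ˢ tsupport χ) :=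
    isCompact_Icc.prod (isCompact_Icc.prod hχc)
  have hC' : ContinuousOn (fun x : ℝ × ℝ × EuclideanSpace ℝ (Fin d) => C x.1)
      (Icc 0 T ×ˢ Icc (0 : ℝ) 1 ×ˢ tsupport χ) := hC.comp continuousOn_fst fun x hx => hx.1
  have hζ' : ContinuousOn (fun x : ℝ × ℝ × EuclideanSpace ℝ (Fin d) => ζ x.1)
      (Icc 0 T ×ˢ Icc (0 : ℝ) 1 ×ˢ tsupport χ) := hζ.comp continuousOn_fst fun x hx => hx.1
  have hcos : ContinuousOn (fun x : ℝ × ℝ × EuclideanSpace ℝ (Fin d) =>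
      cutoffErrorCos χ σ P (C x.1) x.2.1 x.2.2) (Icc 0 T ×ˢ Icc (0 : ℝ) 1 ×ˢ tsupport χ) :=
    (continuous_cutoffErrorCos hχ σ P).comp_continuousOn
      (f := fun x : ℝ × ℝ × EuclideanSpace ℝ (Fin d) => (C x.1, x.2)) (hC'.prodMk continuousOn_snd)
  have hsin : ContinuousOn (fun x : ℝ × ℝ × EuclideanSpace ℝ (Fin d) =>
      cutoffErrorSin χ σ (C x.1) (ζ x.1) x.2.1 x.2.2)
      (Icc 0 T ×ˢ Icc (0 : ℝ) 1 ×ˢ tsupport χ) :=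
    (continuous_cutoffErrorSin hχ σ).comp_continuousOn
      (f := fun x : ℝ × ℝ × EuclideanSpace ℝ (Fin d) => (C x.1, ζ x.1, x.2))
      (hC'.prodMk (hζ'.prodMk continuousOn_snd))
  obtain ⟨b₁, hb₁⟩ := hcomp.exists_bound_of_continuousOn hcos
  obtain ⟨b₂, hb₂⟩ := hcomp.exists_bound_of_continuousOn hsin
  obtain ⟨b₃, hb₃⟩ := isCompact_Icc.exists_bound_of_continuousOn ha
  refine ⟨max b₃ 0 * (max b₁ 0 + max b₂ 0), fun s hs ρ hρ u => ?_⟩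
  rw [cutoffError, norm_mul]
  have h1 : ‖cutoffErrorCos χ σ P (C s) ρ (ρ • (u - u₀))‖ ≤ max b₁ 0 := by
    by_cases hz : ρ • (u - u₀) ∈ tsupport χ
    · exact (hb₁ (s, ρ, _) ⟨hs, hρ, hz⟩).trans (le_max_left _ _)
    · rw [cutoffErrorCos_eq_zero _ _ _ _ hz, norm_zero]
      exact le_max_right _ _
  have h2 : ‖cutoffErrorSin χ σ (C s) (ζ s) ρ (ρ • (u - u₀))‖ ≤ max b₂ 0 := by
    by_cases hz : ρ • (u - u₀) ∈ tsupport χ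
    · exact (hb₂ (s, ρ, _) ⟨hs, hρ, hz⟩).trans (le_max_left _ _)
    · rw [cutoffErrorSin_eq_zero _ _ _ _ hz, norm_zero]
      exact le_max_right _ _
  refine mul_le_mul ((hb₃ s hs).trans (le_max_left _ _)) ((norm_sub_le _ _).trans
    (add_le_add ?_ ?_)) (norm_nonneg _) (le_max_right _ _)
  · rw [norm_mul]
    exact (mul_le_of_le_one_left (norm_nonneg _) (Real.abs_cos_le_one _)).trans h1
  · rw [norm_mul]
    exact (mul_le_of_le_one_left (norm_nonneg _) (Real.abs_sin_le_one _)).trans h2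

end

theorem inner_toEuclideanLin_transpose {d : ℕ} (A : Matrix (Fin d) (Fin d) ℝ)
    (x y : EuclideanSpace ℝ (Fin d)) :
    inner ℝ (toEuclideanLin Aᵀ x) y = inner ℝ x (toEuclideanLin A y) := by
  simp only [EuclideanSpace.inner_eq_star_dotProduct, star_trivial, ofLp_toLpLin, toLin'_apply]
  rw [mulVec_transpose, dotProduct_comm, ← dotProduct_mulVec, dotProduct_comm]

/-! ### Conservation of plane-wave integrals. -/

section

variable {d : ℕ} {σ : ℝ} {B : Matrix (Fin d) (Fin d) ℝ} {u₀ : EuclideanSpace ℝ (Fin d)}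
  {C : ℝ → Matrix (Fin d) (Fin d) ℝ} {f : ℝ → ProbabilityMeasure (EuclideanSpace ℝ (Fin d))}
  {ζ : ℝ → EuclideanSpace ℝ (Fin d)} {a : ℝ → ℝ}

/-- The equations for `ζ` and `a` are those for which the time derivative of the test function
cancels the generator, except for the terms created by the cutoff. -/
theorem IsFokkerPlanckSolution.integral_cutoffError (hf : IsFokkerPlanckSolution σ B u₀ C f)
    (hC : ContinuousOn C (Ici 0))
    (hζ : ∀ s, 0 ≤ s → HasDerivAt ζ (toEuclideanLin (C s * B⁻¹)ᵀ (ζ s)) s)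
    (ha : ∀ s, 0 ≤ s → HasDerivAt a (a s * (σ * ((ζ s).ofLp ⬝ᵥ C s *ᵥ (ζ s).ofLp))) s)
    {χ : EuclideanSpace ℝ (Fin d) → ℝ} (hχ : ContDiff ℝ ∞ χ) (hχc : HasCompactSupport χ)
    (θ : ℝ) {ρ : ℝ} (hρ : ρ ≠ 0) {T : ℝ} (hT : 0 ≤ T) :
    ContinuousOn (fun s => ∫ u, cutoffError χ σ B⁻¹ u₀ θ (C s) (a s) (ζ s) ρ u
      ∂(f s : Measure (EuclideanSpace ℝ (Fin d)))) (Ici 0) ∧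
    ∫ s in (0 : ℝ)..T, ∫ u, cutoffError χ σ B⁻¹ u₀ θ (C s) (a s) (ζ s) ρ u
        ∂(f s : Measure (EuclideanSpace ℝ (Fin d))) =
      a T * ∫ u, cutoffWave χ u₀ θ ρ (ζ T) u ∂(f T : Measure (EuclideanSpace ℝ (Fin d))) -
      a 0 * ∫ u, cutoffWave χ u₀ θ ρ (ζ 0) u ∂(f 0 : Measure (EuclideanSpace ℝ (Fin d))) := by
  have hζc : ContinuousOn ζ (Ici 0) := fun s hs => (hζ s hs).continuousAt.continuousWithinAt
  have hac : ContinuousOn a (Ici 0) := fun s hs => (ha s hs).continuousAt.continuousWithinAt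
  have hχ0 := hχ.continuous
  -- Only frequency and amplitude move in time, not the cutoff, so one compact set contains all
  -- supports.
  set K := (fun z => u₀ + ρ⁻¹ • z) '' tsupport χ with hKdef
  have hK : IsCompact K := IsCompact.image hχc (by fun_prop)
  have hnot : ∀ u ∉ K, ρ • (u - u₀) ∉ tsupport χ := fun u hu h =>
    hu ⟨_, h, by simp [smul_smul, inv_mul_cancel₀ hρ]⟩
  set q : ℝ → ℝ := fun s => (ζ s).ofLp ⬝ᵥ C s *ᵥ (ζ s).ofLp with hq
  set L : ℝ → ℝ → EuclideanSpace ℝ (Fin d) → ℝ := fun r s u =>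
    cutoffError χ σ B⁻¹ u₀ θ (C r) (a s) (ζ s) ρ u -
      a s * χ (ρ • (u - u₀)) * (σ * ((ζ s).ofLp ⬝ᵥ C r *ᵥ (ζ s).ofLp) *
        Real.cos (inner ℝ (ζ s) (u - u₀) + θ) - Real.sin (inner ℝ (ζ s) (u - u₀) + θ) *
          inner ℝ (ζ s) (toEuclideanLin (C r * B⁻¹) (u - u₀))) with hLdef
  set ψ : ℝ → EuclideanSpace ℝ (Fin d) → ℝ := fun s u =>
    a s * χ (ρ • (u - u₀)) * (σ * q s * Real.cos (inner ℝ (ζ s) (u - u₀) + θ) -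
      Real.sin (inner ℝ (ζ s) (u - u₀) + θ) *
        inner ℝ (ζ s) (toEuclideanLin (C s * B⁻¹) (u - u₀))) with hψdef
  have hadj : ∀ r s u, adjointOperator σ B u₀ (C r) (fun u => a s * cutoffWave χ u₀ θ ρ (ζ s) u) u =
      L r s u := fun r s u => adjointOperator_cutoffWave hχ σ B (C r) u₀ (a s) θ ρ (ζ s) u
  have hψcont : Continuous fun x : Matrix (Fin d) (Fin d) ℝ × ℝ × EuclideanSpace ℝ (Fin d) ×
      EuclideanSpace ℝ (Fin d) => x.2.1 * χ (ρ • (x.2.2.2 - u₀)) *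
        (σ * (x.2.2.1.ofLp ⬝ᵥ x.1 *ᵥ x.2.2.1.ofLp) *
        Real.cos (inner ℝ x.2.2.1 (x.2.2.2 - u₀) + θ) -
          Real.sin (inner ℝ x.2.2.1 (x.2.2.2 - u₀) + θ) *
          inner ℝ x.2.2.1 (toEuclideanLin (x.1 * B⁻¹) (x.2.2.2 - u₀))) := by
    simp only [toLpLin_apply]
    fun_prop
  have hLcont : Continuous fun x : Matrix (Fin d) (Fin d) ℝ × ℝ × EuclideanSpace ℝ (Fin d) ×
      EuclideanSpace ℝ (Fin d) => cutoffError χ σ B⁻¹ u₀ θ x.1 x.2.1 x.2.2.1 ρ x.2.2.2 :=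
    (continuous_cutoffError σ B⁻¹ u₀ θ hχ).comp
      (f := fun x : Matrix (Fin d) (Fin d) ℝ × ℝ × EuclideanSpace ℝ (Fin d) ×
      EuclideanSpace ℝ (Fin d) => (x.1, x.2.1, x.2.2.1, ρ, x.2.2.2)) (by fun_prop)
  have hφcont : Continuous fun x : ℝ × EuclideanSpace ℝ (Fin d) ×
      EuclideanSpace ℝ (Fin d) => x.1 * cutoffWave χ u₀ θ ρ x.2.1 x.2.2 := by
    unfold cutoffWave
    fun_prop
  have hfst : ∀ {Y : Type} [TopologicalSpace Y] {g : ℝ → Y}, ContinuousOn g (Ici 0) →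
      ContinuousOn (fun x : ℝ × EuclideanSpace ℝ (Fin d) => g x.1) (Ici 0 ×ˢ univ) :=
    fun hg => hg.comp continuousOn_fst fun x hx => hx.1
  have hfst' : ∀ {Y : Type} [TopologicalSpace Y] {g : ℝ → Y}, ContinuousOn g (Ici 0) →
      ContinuousOn (fun x : (ℝ × ℝ) × EuclideanSpace ℝ (Fin d) => g x.1.1)
        ((Ici 0 ×ˢ Ici 0) ×ˢ univ) :=
    fun hg => hg.comp (continuous_fst.comp continuous_fst).continuousOn fun x hx => hx.1.1
  have hsnd' : ∀ {Y : Type} [TopologicalSpace Y] {g : ℝ → Y}, ContinuousOn g (Ici 0) →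
      ContinuousOn (fun x : (ℝ × ℝ) × EuclideanSpace ℝ (Fin d) => g x.1.2)
        ((Ici 0 ×ˢ Ici 0) ×ˢ univ) :=
    fun hg => hg.comp (continuous_snd.comp continuous_fst).continuousOn fun x hx => hx.1.2
  have hmain := integral_sub_integral_of_weak_equation hK hf.continuousOn
    (φ := fun s u => a s * cutoffWave χ u₀ θ ρ (ζ s) u) (ψ := ψ) (L := L)
    (hφcont.comp_continuousOn ((hfst hac).prodMk ((hfst hζc).prodMk continuousOn_snd)))
    (hψcont.comp_continuousOn ((hfst hC).prodMk ((hfst hac).prodMk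
      ((hfst hζc).prodMk continuousOn_snd))))
    (((hLcont.sub hψcont).comp_continuousOn ((hfst' hC).prodMk ((hsnd' hac).prodMk
      ((hsnd' hζc).prodMk continuousOn_snd)))))
    (fun s u hu => by
      simp only [cutoffWave, image_eq_zero_of_notMem_tsupport (hnot u hu), zero_mul, mul_zero])
    (fun s u hu => by
      simp only [hψdef, image_eq_zero_of_notMem_tsupport (hnot u hu), zero_mul, mul_zero])
    (fun r s u hu => by
      simp only [hLdef, cutoffError, image_eq_zero_of_notMem_tsupport (hnot u hu),
        cutoffErrorCos_eq_zero _ _ _ _ (hnot u hu), cutoffErrorSin_eq_zero _ _ _ _ (hnot u hu),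
        zero_mul, mul_zero, sub_zero])
    (fun s hs u => ?_) (fun s t hs ht => ?_) hT
  · have hsum : ∀ s u, ψ s u + L s s u = cutoffError χ σ B⁻¹ u₀ θ (C s) (a s) (ζ s) ρ u :=
      fun s u => add_sub_cancel _ _
    simp only [hsum, integral_const_mul] at hmain
    exact hmain
  · have h1 : HasDerivAt (fun s => inner ℝ (ζ s) (u - u₀) + θ)
        (inner ℝ (ζ s) (toEuclideanLin (C s * B⁻¹) (u - u₀))) s := by
      have := ((hζ s hs.le).inner ℝ (hasDerivAt_const s (u - u₀))).add_const θ
      simpa [inner_toEuclideanLin_transpose] using this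
    refine ((ha s hs.le).fun_mul (h1.cos.const_mul (χ (ρ • (u - u₀))))).congr_deriv ?_
    simp only [hψdef, hq]
    ring
  · rw [hf.weak_equation (fun u => a s * cutoffWave χ u₀ θ ρ (ζ s) u)
      (contDiff_const.mul (contDiff_cutoffWave u₀ θ ρ (ζ s) hχ))
      (HasCompactSupport.intro hK fun u hu => by
        simp only [cutoffWave, image_eq_zero_of_notMem_tsupport (hnot u hu), zero_mul, mul_zero])
      t ht]
    simp only [hadj]

open Filter Topology in
/-- Plane waves transported by the backward equation have a conserved integral along weak
solutions of the Fokker–Planck equation. -/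
theorem IsFokkerPlanckSolution.integral_wave (hf : IsFokkerPlanckSolution σ B u₀ C f)
    (hC : ContinuousOn C (Ici 0))
    (hζ : ∀ s, 0 ≤ s → HasDerivAt ζ (toEuclideanLin (C s * B⁻¹)ᵀ (ζ s)) s)
    (ha : ∀ s, 0 ≤ s → HasDerivAt a (a s * (σ * ((ζ s).ofLp ⬝ᵥ C s *ᵥ (ζ s).ofLp))) s)
    (θ : ℝ) {T : ℝ} (hT : 0 ≤ T) :
    a T * ∫ u, Real.cos (inner ℝ (ζ T) (u - u₀) + θ)
        ∂(f T : Measure (EuclideanSpace ℝ (Fin d))) =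
      a 0 * ∫ u, Real.cos (inner ℝ (ζ 0) (u - u₀) + θ)
        ∂(f 0 : Measure (EuclideanSpace ℝ (Fin d))) := by
  have hζc : ContinuousOn ζ (Ici 0) := fun s hs => (hζ s hs).continuousAt.continuousWithinAt
  have hac : ContinuousOn a (Ici 0) := fun s hs => (ha s hs).continuousAt.continuousWithinAt
  let χ : ContDiffBump (0 : EuclideanSpace ℝ (Fin d)) := ⟨1, 2, one_pos, one_lt_two⟩
  have hχ : ContDiff ℝ ∞ (χ : EuclideanSpace ℝ (Fin d) → ℝ) := χ.contDiff
  have hχ0 : χ 0 = 1 := χ.one_of_mem_closedBall (by simp [χ])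
  set ρ : ℕ → ℝ := fun n => 1 / ((n : ℝ) + 1) with hρdef
  have hρ : Tendsto ρ atTop (𝓝 0) := tendsto_one_div_add_atTop_nhds_zero_nat
  have hρ0 : ∀ n, 0 < ρ n := fun n => by positivity
  have hρ1 : ∀ n, ρ n ≤ 1 := fun n => by
    rw [hρdef]
    exact div_le_one_of_le₀ (by linarith [n.cast_nonneg (α := ℝ)]) (by positivity)
  have hwave : ∀ t, Tendsto (fun n => a t * ∫ u, cutoffWave χ u₀ θ (ρ n) (ζ t) u
      ∂(f t : Measure (EuclideanSpace ℝ (Fin d)))) atTop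
      (𝓝 (a t * ∫ u, Real.cos (inner ℝ (ζ t) (u - u₀) + θ)
        ∂(f t : Measure (EuclideanSpace ℝ (Fin d))))) := fun t => by
    refine Tendsto.const_mul _ (tendsto_integral_of_dominated_convergence (fun _ => (1 : ℝ))
      (fun n => (contDiff_cutoffWave u₀ θ (ρ n) (ζ t) hχ).continuous.aestronglyMeasurable)
      (integrable_const _) (fun n => Eventually.of_forall fun u => ?_)
      (Eventually.of_forall fun u => ?_))
    · rw [cutoffWave, norm_mul]
      refine mul_le_one₀ ?_ (norm_nonneg _) (Real.abs_cos_le_one _)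
      rw [Real.norm_eq_abs, abs_of_nonneg χ.nonneg]
      exact χ.le_one
    · have h1 : Tendsto (fun n => χ (ρ n • (u - u₀))) atTop (𝓝 (χ ((0 : ℝ) • (u - u₀)))) :=
        (hχ.continuous.tendsto _).comp (hρ.smul_const _)
      rw [zero_smul, hχ0] at h1
      simpa [cutoffWave] using h1.mul_const (Real.cos (inner ℝ (ζ t) (u - u₀) + θ))
  have hsub : Icc 0 T ⊆ Ici 0 := Icc_subset_Ici_self
  obtain ⟨b, hb⟩ := exists_bound_cutoffError σ B⁻¹ u₀ θ hχ χ.hasCompactSupport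
    (hC.mono hsub) (hac.mono hsub) (hζc.mono hsub)
  have hid := fun n => hf.integral_cutoffError hC hζ ha hχ χ.hasCompactSupport θ (hρ0 n).ne' hT
  have hIoc : ∀ s ∈ uIoc 0 T, s ∈ Icc 0 T := fun s hs => by
    rw [uIoc_of_le hT] at hs
    exact Ioc_subset_Icc_self hs
  -- Dominated convergence is used twice with the same constant `b`: in `u` for each fixed `s`, then
  -- in `s`.
  have herr : Tendsto (fun n => ∫ s in (0 : ℝ)..T, ∫ u,
      cutoffError χ σ B⁻¹ u₀ θ (C s) (a s) (ζ s) (ρ n) u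
        ∂(f s : Measure (EuclideanSpace ℝ (Fin d)))) atTop (𝓝 (∫ _ in (0 : ℝ)..T, (0 : ℝ))) := by
    refine intervalIntegral.tendsto_integral_filter_of_dominated_convergence (fun _ => b)
      (Eventually.of_forall fun n => ?_)
      (Eventually.of_forall fun n => Eventually.of_forall fun s hs => ?_) (by simp)
      (Eventually.of_forall fun s hs => ?_)
    · exact ((hid n).1.mono fun s hs => (hIoc s hs).1).aestronglyMeasurable measurableSet_uIoc
    · refine (norm_integral_le_of_norm_le_const (C := b) (Eventually.of_forall fun u =>
        hb s (hIoc s hs) (ρ n) ⟨(hρ0 n).le, hρ1 n⟩ u)).trans ?_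
      simp
    · have hcont : ∀ ρ, Continuous fun u => cutoffError χ σ B⁻¹ u₀ θ (C s) (a s) (ζ s) ρ u :=
        fun ρ => (continuous_cutoffError σ B⁻¹ u₀ θ hχ).comp
          (f := fun u => (C s, a s, ζ s, ρ, u)) (by fun_prop)
      have := tendsto_integral_of_dominated_convergence
        (μ := (f s : Measure (EuclideanSpace ℝ (Fin d))))
        (F := fun n u => cutoffError χ σ B⁻¹ u₀ θ (C s) (a s) (ζ s) (ρ n) u)
        (f := fun _ => (0 : ℝ)) (fun _ => b)
        (fun n => (hcont (ρ n)).aestronglyMeasurable) (integrable_const _)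
        (fun n => Eventually.of_forall fun u =>
          hb s (hIoc s hs) (ρ n) ⟨(hρ0 n).le, hρ1 n⟩ u)
        (Eventually.of_forall fun u => ?_)
      · simpa using this
      · have h1 : Continuous fun ρ => cutoffError χ σ B⁻¹ u₀ θ (C s) (a s) (ζ s) ρ u :=
          (continuous_cutoffError σ B⁻¹ u₀ θ hχ).comp
            (f := fun ρ => (C s, a s, ζ s, ρ, u)) (by fun_prop)
        have h2 := (h1.tendsto 0).comp hρ
        rwa [cutoffError_zero_scale] at h2
  rw [intervalIntegral.integral_zero] at herr
  have hlim := (hwave T).sub (hwave 0)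
  refine sub_eq_zero.1 (tendsto_nhds_unique (hlim.congr fun n => ?_) herr)
  exact (hid n).2.symm

end

/-! ### Representation of solutions by characteristic functions. -/

/-- The phases `0` and `-π/2` produce the cosine and the sine, so real test functions determine the
characteristic function. Centring at `u₀` costs only a phase factor. -/
theorem charFun_eq_integral_cos {d : ℕ} (μ : Measure (EuclideanSpace ℝ (Fin d)))
    [IsProbabilityMeasure μ] (u₀ ξ : EuclideanSpace ℝ (Fin d)) :
    charFun μ ξ = Complex.exp (inner ℝ ξ u₀ * Complex.I) *
      ((∫ u, Real.cos (inner ℝ ξ (u - u₀) + 0) ∂μ : ℝ) +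
        (∫ u, Real.cos (inner ℝ ξ (u - u₀) + -(Real.pi / 2)) ∂μ : ℝ) * Complex.I) := by
  have hint : ∀ θ, Integrable (fun u => Real.cos (inner ℝ ξ (u - u₀) + θ)) μ := fun θ =>
    Integrable.of_bound (C := 1) (by fun_prop)
      (Filter.Eventually.of_forall fun u => Real.abs_cos_le_one _)
  rw [charFun_apply, ← integral_complex_ofReal, ← integral_complex_ofReal, ← integral_mul_const,
    ← integral_add (hint 0).ofReal ((hint _).ofReal.mul_const _), ← integral_const_mul]
  refine integral_congr_ae (Filter.Eventually.of_forall fun u => ?_)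
  have h1 : Real.cos (inner ℝ ξ (u - u₀) + -(Real.pi / 2)) = Real.sin (inner ℝ ξ (u - u₀)) := by
    rw [← sub_eq_add_neg, Real.cos_sub_pi_div_two]
  simp only [h1, add_zero]
  rw [Complex.ofReal_cos, Complex.ofReal_sin, ← Complex.exp_mul_I, ← Complex.exp_add, ← add_mul,
    ← Complex.ofReal_add, ← inner_add_right, add_sub_cancel, real_inner_comm]

/-- The affine map with linear part `V` that fixes `u₀`. -/
noncomputable def affineFix {d : ℕ} (V : Matrix (Fin d) (Fin d) ℝ)
    (u₀ u : EuclideanSpace ℝ (Fin d)) : EuclideanSpace ℝ (Fin d) :=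
  toEuclideanLin V (u - u₀) + u₀

theorem continuous_affineFix {d : ℕ} (V : Matrix (Fin d) (Fin d) ℝ)
    (u₀ : EuclideanSpace ℝ (Fin d)) : Continuous (affineFix V u₀) := by
  have : Continuous (toEuclideanLin V : EuclideanSpace ℝ (Fin d) → _) :=
    LinearMap.continuous_of_finiteDimensional _
  unfold affineFix
  fun_prop

theorem enorm_toEuclideanLin_le {d : ℕ} (V : Matrix (Fin d) (Fin d) ℝ)
    (x : EuclideanSpace ℝ (Fin d)) : ‖toEuclideanLin V x‖ₑ ≤ ENNReal.ofReal ‖V‖ * ‖x‖ₑ := by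
  rw [← ofReal_norm, ← ofReal_norm, ← ENNReal.ofReal_mul (norm_nonneg _)]
  exact ENNReal.ofReal_le_ofReal (l2_opNorm_mulVec V x)

theorem edist_affineFix_le {d : ℕ} (V : Matrix (Fin d) (Fin d) ℝ)
    (u₀ x y : EuclideanSpace ℝ (Fin d)) :
    edist (affineFix V u₀ x) (affineFix V u₀ y) ≤ ENNReal.ofReal ‖V‖ * edist x y := by
  have h : affineFix V u₀ x - affineFix V u₀ y = toEuclideanLin V (x - y) := by
    simp only [affineFix, map_sub]
    abel
  rw [edist_eq_enorm_sub, edist_eq_enorm_sub, h]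
  exact enorm_toEuclideanLin_le V _

/-- Weak solutions of the Fokker–Planck equation are images of their initial values under an
affine map, convolved with a Gaussian which does not depend on the solution. -/
theorem IsFokkerPlanckSolution.eq_conv {d : ℕ} {σ : ℝ} (hσ : 0 ≤ σ)
    {B : Matrix (Fin d) (Fin d) ℝ} {u₀ : EuclideanSpace ℝ (Fin d)}
    {C : ℝ → Matrix (Fin d) (Fin d) ℝ} {f : ℝ → ProbabilityMeasure (EuclideanSpace ℝ (Fin d))}
    (hf : IsFokkerPlanckSolution σ B u₀ C f) (hC : ContinuousOn C (Ici 0))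
    (hC₀ : (C 0).PosSemidef) {V W : ℝ → Matrix (Fin d) (Fin d) ℝ}
    (hV0 : V 0 = 1) (hWV : ∀ t, 0 ≤ t → W t * V t = 1) (hVW : ∀ t, 0 ≤ t → V t * W t = 1)
    (hW : ∀ t, 0 ≤ t → HasDerivAt W (W t * C t * B⁻¹) t)
    (hCV : ∀ t, 0 ≤ t → C t = Real.exp (2 * σ * t) • (V t * C 0 * (V t)ᵀ)) {T : ℝ} (hT : 0 ≤ T) :
    (f T : Measure (EuclideanSpace ℝ (Fin d))) =
      ((f 0 : Measure (EuclideanSpace ℝ (Fin d))).map (affineFix (V T) u₀)) ∗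
        ProbabilityTheory.multivariateGaussian 0
          ((Real.exp (2 * σ * T) - 1) • (V T * C 0 * (V T)ᵀ)) := by
  have hcovP : ((Real.exp (2 * σ * T) - 1) • (V T * C 0 * (V T)ᵀ)).PosSemidef := by
    refine Matrix.PosSemidef.smul ?_ (sub_nonneg.2 (Real.one_le_exp (by positivity)))
    simpa [conjTranspose_eq_transpose_of_trivial] using hC₀.mul_mul_conjTranspose_same (V T)
  have hmeas : Measurable (affineFix (V T) u₀) := (continuous_affineFix _ _).measurable
  have := Measure.isProbabilityMeasure_map (μ := (f 0 : Measure (EuclideanSpace ℝ (Fin d))))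
    hmeas.aemeasurable
  refine Measure.ext_of_charFun (funext fun ξ => ?_)
  rw [charFun_conv, ProbabilityTheory.charFun_multivariateGaussian hcovP,
    charFun_eq_integral_cos _ u₀ ξ, charFun_eq_integral_cos (Measure.map _ _) u₀ ξ]
  -- This starting frequency makes the wave `ζ s = (W s)ᵀ η` arrive at the prescribed `ξ` at time
  -- `T`.
  set η : EuclideanSpace ℝ (Fin d) := toEuclideanLin (V T)ᵀ ξ with hη
  set κ : ℝ := η.ofLp ⬝ᵥ C 0 *ᵥ η.ofLp with hκ
  have hW0 : W 0 = 1 := by simpa [hV0] using hWV 0 le_rfl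
  set ζ : ℝ → EuclideanSpace ℝ (Fin d) := fun s => toEuclideanLin (W s)ᵀ η with hζ
  -- Since `C s = exp (2σs) V (C 0) Vᵀ`, the form `ζ · C ζ` equals `exp (2σs) κ`, and the amplitude
  -- equation integrates explicitly. The ratio `a 0 / a T` is the Gaussian factor.
  set a : ℝ → ℝ := fun s => Real.exp (Real.exp (2 * σ * s) * κ / 2) with ha
  have hζT : ζ T = ξ := by
    simp only [hζ, hη, toLpLin_apply, mulVec_mulVec, ← transpose_mul, hVW T hT]
    simp
  have hζ0 : ζ 0 = η := by
    simp only [hζ, hW0, toLpLin_apply]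
    simp
  have hζ' : ∀ s, 0 ≤ s → HasDerivAt ζ (toEuclideanLin (C s * B⁻¹)ᵀ (ζ s)) s := fun s hs => by
    let l : Matrix (Fin d) (Fin d) ℝ →ₗ[ℝ] EuclideanSpace ℝ (Fin d) :=
      { toFun := fun M => toEuclideanLin Mᵀ η
        map_add' := fun M N => by simp [transpose_add]
        map_smul' := fun c M => by simp [transpose_smul] }
    have := (l.toContinuousLinearMap.hasFDerivAt (x := W s)).comp_hasDerivAt s (hW s hs)
    refine this.congr_deriv ?_
    change toEuclideanLin (W s * C s * B⁻¹)ᵀ η = _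
    simp only [hζ, toLpLin_apply, mulVec_mulVec, ← transpose_mul, Matrix.mul_assoc]
  have hquad : ∀ s, 0 ≤ s → (ζ s).ofLp ⬝ᵥ C s *ᵥ (ζ s).ofLp = Real.exp (2 * σ * s) * κ :=
    fun s hs => by
    have h1 : (V s)ᵀ *ᵥ (ζ s).ofLp = η.ofLp := by
      simp only [hζ, toLpLin_apply, mulVec_mulVec, ← transpose_mul, hWV s hs]
      simp
    rw [hCV s hs, smul_mulVec, dotProduct_smul, smul_eq_mul, ← mulVec_mulVec, ← mulVec_mulVec,
      dotProduct_mulVec, ← mulVec_transpose, h1]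
  have ha' : ∀ s, 0 ≤ s →
      HasDerivAt a (a s * (σ * ((ζ s).ofLp ⬝ᵥ C s *ᵥ (ζ s).ofLp))) s := fun s hs => by
    have h1 : HasDerivAt (fun s => 2 * σ * s) (2 * σ) s := by
      simpa using (hasDerivAt_id s).const_mul (2 * σ)
    refine ((h1.exp.mul_const κ).div_const 2).exp.congr_deriv ?_
    rw [hquad s hs]
    simp only [ha]
    ring
  have hwave : ∀ θ, ∫ u, Real.cos (inner ℝ ξ (u - u₀) + θ)
      ∂(f T : Measure (EuclideanSpace ℝ (Fin d))) =
      Real.exp (-((Real.exp (2 * σ * T) - 1) * κ / 2)) *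
        ∫ u, Real.cos (inner ℝ ξ (u - u₀) + θ)
          ∂((f 0 : Measure (EuclideanSpace ℝ (Fin d))).map (affineFix (V T) u₀)) := fun θ => by
    have h1 := hf.integral_wave hC hζ' ha' θ hT
    rw [hζT, hζ0] at h1
    rw [integral_map hmeas.aemeasurable (by fun_prop)]
    have h2 : ∀ u, inner ℝ ξ (affineFix (V T) u₀ u - u₀) = inner ℝ η (u - u₀) := fun u => by
      rw [affineFix, add_sub_cancel_right, hη, inner_toEuclideanLin_transpose]
    simp only [h2]
    have h3 : a 0 = a T * Real.exp (-((Real.exp (2 * σ * T) - 1) * κ / 2)) := by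
      simp only [ha]
      rw [← Real.exp_add]
      congr 1
      simp only [mul_zero, Real.exp_zero]
      ring
    rw [h3, mul_assoc] at h1
    exact mul_left_cancel₀ (Real.exp_pos _).ne' h1
  have hcov : ξ.ofLp ⬝ᵥ ((Real.exp (2 * σ * T) - 1) • (V T * C 0 * (V T)ᵀ)) *ᵥ ξ.ofLp =
      (Real.exp (2 * σ * T) - 1) * κ := by
    rw [smul_mulVec, dotProduct_smul, smul_eq_mul, ← mulVec_mulVec, ← mulVec_mulVec,
      dotProduct_mulVec, ← mulVec_transpose]
    rfl
  rw [hwave, hwave, hcov]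
  simp only [inner_zero_right, Complex.ofReal_zero, zero_mul, zero_sub]
  push_cast
  ring

/-! ### Synchronous coupling. -/

theorem map_add_prod_eq_conv {Ω E : Type*} [MeasurableSpace Ω] [AddMonoid E] [MeasurableSpace E]
    [MeasurableAdd₂ E] (γ : Measure Ω) [SFinite γ] (N : Measure E) [SFinite N] {X : Ω → E}
    (hX : Measurable X) : (γ.prod N).map (fun q => X q.1 + q.2) = (γ.map X) ∗ N := by
  have h := Measure.map_prod_map γ N hX measurable_id
  rw [Measure.map_id] at h
  rw [Measure.conv, h, Measure.map_map (by fun_prop) (by fun_prop)]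
  rfl

/-- Given a coupling of the initial laws, both components receive the same independent noise with
law `N`. It cancels in the difference, leaving only the linear part `V`. -/
theorem wasserstein2_le_of_eq_conv {d : ℕ}
    {μ₁ μ₂ ν₁ ν₂ : ProbabilityMeasure (EuclideanSpace ℝ (Fin d))}
    (N : Measure (EuclideanSpace ℝ (Fin d))) [IsProbabilityMeasure N]
    {V : Matrix (Fin d) (Fin d) ℝ} {u₀ : EuclideanSpace ℝ (Fin d)} {c : ℝ} (hc : ‖V‖ ≤ c)
    (h₁ : (ν₁ : Measure (EuclideanSpace ℝ (Fin d))) =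
      ((μ₁ : Measure (EuclideanSpace ℝ (Fin d))).map (affineFix V u₀)) ∗ N)
    (h₂ : (ν₂ : Measure (EuclideanSpace ℝ (Fin d))) =
      ((μ₂ : Measure (EuclideanSpace ℝ (Fin d))).map (affineFix V u₀)) ∗ N) :
    wasserstein2 ν₁ ν₂ ≤ ENNReal.ofReal c * wasserstein2 μ₁ μ₂ := by
  have hmeas : Measurable (affineFix V u₀) := (continuous_affineFix V u₀).measurable
  have hbound : ∀ γ ∈ couplings (μ₁ : Measure (EuclideanSpace ℝ (Fin d))) μ₂,
      (⨅ γ' ∈ couplings (ν₁ : Measure (EuclideanSpace ℝ (Fin d))) ν₂,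
        ∫⁻ p, edist p.1 p.2 ^ 2 ∂γ') ≤ ENNReal.ofReal c ^ 2 * ∫⁻ p, edist p.1 p.2 ^ 2 ∂γ := by
    rintro γ ⟨hγ₁, hγ₂⟩
    have hγ : IsProbabilityMeasure γ := by
      have : IsProbabilityMeasure (γ.map Prod.fst) := hγ₁ ▸ inferInstance
      exact (Measure.isProbabilityMeasure_map_iff measurable_fst.aemeasurable).1 this
    set F : (EuclideanSpace ℝ (Fin d) × EuclideanSpace ℝ (Fin d)) × EuclideanSpace ℝ (Fin d) →
        EuclideanSpace ℝ (Fin d) × EuclideanSpace ℝ (Fin d) :=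
      fun q => (affineFix V u₀ q.1.1 + q.2, affineFix V u₀ q.1.2 + q.2) with hF
    have hFm : Measurable F := by fun_prop
    have hmem : (γ.prod N).map F ∈ couplings (ν₁ : Measure (EuclideanSpace ℝ (Fin d))) ν₂ := by
      constructor
      · rw [Measure.map_map measurable_fst hFm, h₁, ← hγ₁, Measure.map_map hmeas measurable_fst,
          ← map_add_prod_eq_conv γ N (hmeas.comp measurable_fst)]
        rfl
      · rw [Measure.map_map measurable_snd hFm, h₂, ← hγ₂, Measure.map_map hmeas measurable_snd,
          ← map_add_prod_eq_conv γ N (hmeas.comp measurable_snd)]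
        rfl
    refine (iInf₂_le _ hmem).trans ?_
    rw [lintegral_map (by fun_prop) hFm]
    calc ∫⁻ q, edist (F q).1 (F q).2 ^ 2 ∂(γ.prod N)
          ≤ ∫⁻ q, ENNReal.ofReal c ^ 2 * edist q.1.1 q.1.2 ^ 2 ∂(γ.prod N) := by
            refine lintegral_mono fun q => ?_
            simp only [hF, edist_add_right]
            rw [← mul_pow]
            gcongr
            exact (edist_affineFix_le V u₀ _ _).trans (by gcongr)
        _ = ENNReal.ofReal c ^ 2 * ∫⁻ q, edist q.1.1 q.1.2 ^ 2 ∂(γ.prod N) :=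
            lintegral_const_mul _ (by fun_prop)
        _ = ENNReal.ofReal c ^ 2 * ∫⁻ p, edist p.1 p.2 ^ 2 ∂γ := by
            have hmp : MeasurePreserving Prod.fst (γ.prod N) γ := measurePreserving_fst
            rw [← hmp.lintegral_comp (f := fun p => edist p.1 p.2 ^ 2) (by fun_prop)]
  -- A coupling is needed when the factor is zero: it cannot then be moved inside the infimum, but
  -- the bound for any single coupling is already zero, even at infinite cost.
  have hprod : (μ₁ : Measure (EuclideanSpace ℝ (Fin d))).prod μ₂ ∈
      couplings (μ₁ : Measure (EuclideanSpace ℝ (Fin d))) μ₂ :=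
    ⟨measurePreserving_fst.map_eq, measurePreserving_snd.map_eq⟩
  have hinf : (⨅ γ' ∈ couplings (ν₁ : Measure (EuclideanSpace ℝ (Fin d))) ν₂,
        ∫⁻ p, edist p.1 p.2 ^ 2 ∂γ') ≤ ENNReal.ofReal c ^ 2 *
      ⨅ γ ∈ couplings (μ₁ : Measure (EuclideanSpace ℝ (Fin d))) μ₂,
        ∫⁻ p, edist p.1 p.2 ^ 2 ∂γ := by
    by_cases h0 : ENNReal.ofReal c = 0
    · refine (hbound _ hprod).trans ?_
      simp [h0]
    · have hne : ENNReal.ofReal c ^ 2 ≠ 0 := pow_ne_zero 2 h0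
      have htop : ENNReal.ofReal c ^ 2 ≠ ⊤ := ENNReal.pow_ne_top ENNReal.ofReal_ne_top
      simp only [ENNReal.mul_iInf_of_ne hne htop]
      exact le_iInf₂ hbound
  unfold wasserstein2
  refine (ENNReal.rpow_le_rpow hinf (by norm_num)).trans_eq ?_
  rw [ENNReal.mul_rpow_of_nonneg _ _ (by norm_num), ← ENNReal.rpow_natCast, ← ENNReal.rpow_mul]
  norm_num

end EnsembleKalman

theorem mainTheorem2 {d K : ℕ} (σ : ℝ) (hσ : 0 ≤ σ)
    (G : Matrix (Fin K) (Fin d) ℝ)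
    (Γ : Matrix (Fin K) (Fin K) ℝ) (hΓ : Γ.PosDef)
    (Γ₀ : Matrix (Fin d) (Fin d) ℝ) (hΓ₀ : Γ₀.PosDef)
    (y : EuclideanSpace ℝ (Fin K))
    (B : Matrix (Fin d) (Fin d) ℝ) (hB : B = EnsembleKalman.matB G Γ Γ₀)
    (u₀ : EuclideanSpace ℝ (Fin d)) (hu₀ : u₀ = EnsembleKalman.minimizer G Γ Γ₀ y)
    (C : ℝ → Matrix (Fin d) (Fin d) ℝ) (hC₀ : (C 0).PosSemidef)
    (hC : EnsembleKalman.IsRiccatiSolution σ B C)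
    (f₁ f₂ : ℝ → ProbabilityMeasure (EuclideanSpace ℝ (Fin d)))
    (hf₁ : EnsembleKalman.IsFokkerPlanckSolution σ B u₀ C f₁)
    (hf₂ : EnsembleKalman.IsFokkerPlanckSolution σ B u₀ C f₂) :
    (∀ U : ℝ → ℝ → Matrix (Fin d) (Fin d) ℝ, EnsembleKalman.IsFundamentalMatrix B C U →
      ∀ t : ℝ, 0 ≤ t →
        EnsembleKalman.wasserstein2 (f₁ t) (f₂ t) ≤
          ENNReal.ofReal (Real.sqrt ‖(U 0 t)ᵀ * U 0 t‖) *
            EnsembleKalman.wasserstein2 (f₁ 0) (f₂ 0)) ∧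
    (∀ m M : ℝ, (C 0).PosDef →
      max ‖C 0‖ ‖B‖ ≤ M → max ‖(C 0)⁻¹‖ ‖B⁻¹‖ ≤ m →
      ∀ t : ℝ, 0 ≤ t →
        EnsembleKalman.wasserstein2 (f₁ t) (f₂ t) ≤
          ENNReal.ofReal (Real.sqrt (m * M) *
            (Real.exp (-σ * t) / Real.sqrt (EnsembleKalman.alpha σ t))) *
            EnsembleKalman.wasserstein2 (f₁ 0) (f₂ 0)) := by
  have hP : B⁻¹.PosDef := hB ▸ EnsembleKalman.posDef_inv_matB G hΓ hΓ₀
  obtain ⟨V, W, hV0, hflow⟩ := hC.exists_flow hP hC₀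
  have hCc : ContinuousOn C (Ici 0) := fun s hs => (hC s hs).continuousWithinAt
  have hcontr : ∀ t c, 0 ≤ t → ‖V t‖ ≤ c → EnsembleKalman.wasserstein2 (f₁ t) (f₂ t) ≤
      ENNReal.ofReal c * EnsembleKalman.wasserstein2 (f₁ 0) (f₂ 0) := fun t c ht hc => by
    have hconv := fun (f : ℝ → ProbabilityMeasure (EuclideanSpace ℝ (Fin d)))
        (hf : EnsembleKalman.IsFokkerPlanckSolution σ B u₀ C f) =>
      hf.eq_conv hσ hCc hC₀ hV0 (fun t ht => (hflow t ht).1) (fun t ht => (hflow t ht).2.1)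
        (fun t ht => (hflow t ht).2.2.1) (fun t ht => (hflow t ht).2.2.2.1) ht
    exact EnsembleKalman.wasserstein2_le_of_eq_conv _ hc (hconv f₁ hf₁) (hconv f₂ hf₂)
  refine ⟨fun U hU t ht => hcontr t _ ht ?_, fun m M hC₀' hM hm t ht => hcontr t _ ht ?_⟩
  · have hUV := hU.eq_of_hasDerivAt hV0 (fun t ht => (hflow t ht).1) (fun t ht => (hflow t ht).2.1)
      (fun t ht => (hflow t ht).2.2.1) ht
    -- The C*-identity: the square root in the statement is `‖U 0 t‖`.
    have h1 := l2_opNorm_conjTranspose_mul_self (U 0 t)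
    rw [conjTranspose_eq_transpose_of_trivial] at h1
    rw [h1, Real.sqrt_mul_self (norm_nonneg _), hUV]
  · exact EnsembleKalman.norm_le_of_riccati_flow hC₀' ((le_max_left _ _).trans hm)
      ((hflow t ht).2.2.2.2 M hM) ht ((norm_nonneg _).trans ((le_max_left _ _).trans hM))
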